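/- **Setting.** Let $b\ge 1$, $K=2^{b-1}$, let $0=t_0<t_1<\dots<t_{K-1}<t_K=+\infty$ be thresholds and $0<\mu_1<\dots<\mu_K$ representatives, and let $Q(z)=\operatorname{sign}(z)\sum_{k=1}^K\mu_k 1(|z|\in[t_{k-1},t_k))$ be the corresponding $b$-bit quantizer. Let $\sigma\ge 0$. In dimension $n$ let $\Sigma=\Sigma_n$ be a known positive definite covariance matrix, let $x^*\in\mathbb R^n\setminus\{0\}$, $x_u^*=x^*/\|x^*\|_2$, and observe $$y_i=Q(\langle a_i,x^*\rangle+\sigma\varepsilon_i),\qquad i=1,\dots,m,$$ with $a_i\sim N(0,\Sigma)$ and $\varepsilon_i\sim N(0,1)$ all independent. Let $\mathcal K\subseteq\mathbb R^n$ be any set with $x_u^*\in\mathcal K$, $\mathcal C=\mathcal K\cap\{\|x\|_2\le 1\}$, $\eta=\frac1m\sum_{i=1}^m y_ia_i$, and $$\widehat x_\Sigma\in\operatorname*{argmin}_{x\in\mathcal C}-\langle x,\Sigma^{-1}\eta\rangle .$$ Let $\overline\Delta=\{\alpha(x-x_u^*):\alpha\ge0,\,x\in\mathcal C\}\cap\mathbb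 S^{n-1}$ and let $w=\mathbf E\sup_{v\in\overline\Delta}|\langle g,v\rangle|$, $g\sim N(0,I_n)$, be its Gaussian width; let $\kappa=\kappa(\Sigma^{1/2})=\|\Sigma^{1/2}\|\,\|\Sigma^{-1/2}\|$ (spectral norms). Put $\psi=\|\Sigma^{1/2}x^*\|_2$ and, for independent $g,\varepsilon\sim N(0,1)$, $\theta(u)=\mathbf E\,Q(\psi u+\sigma\varepsilon)$, $\lambda=\mathbf E[\theta(g)g]$, $\Psi=\sqrt{\mathbf E[Q(\psi g+\sigma\varepsilon)^2]}=\sqrt{\mathbf E[y_1^2]}$. (If the thresholds and $\sigma$ are scaled so that $\psi=1$, then $\lambda,\Psi$ depend only on $Q$ and $\sigma$.) **Theorem.** There is a constant $c>0$, depending only on the quantizer, such that the following holds for all sequences of such problems with $n\to\infty$ ($m,\Sigma,\mathcal K,x^*$ may all vary with $n$) with $\|x_u^*\|_\infty\to0$. For all sufficiently large $n$, every minimizer $\widehat x_\Sigma$ satisfies $$\|\widehat x_\Sigma-x_u^*\|_2\le 24\,\kappa(\Sigma^{1/2})\,\frac{\Psi}{\lambda}\,\frac{w}{\sqrt m}$$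 with probability at least $1-4\big(\exp(-w/2)+\exp(-cm)\big)$. If moreover $\kappa=o(w)$ as $n\to\infty$ (for instance, if $\kappa$ is bounded and $w\to\infty$), then for all sufficiently large $n$ the same bound holds with probability at least $$1-4\big(\exp(-\kappa(\Sigma^{1/2})\,w/2)+\exp(-cm)\big)=1-o(1)-4\exp(-cm).$$ -/

import Mathlib

open MeasureTheory ProbabilityTheory Filter Topology Asymptotics
open scoped RealInnerProductSpace MatrixOrder

noncomputable section

namespace QuantizedRecovery

/-- `ℝⁿ` with the Euclidean norm. -/
abbrev E (n : ℕ) : Type := EuclideanSpace ℝ (Fin n)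

/-! ### The `b`-bit quantizer -/

/-- A symmetric `b`-bit scalar quantizer. With `K = 2 ^ (b - 1)` (and `1 ≤ b`), it is given by
thresholds `0 = t₀ < t₁ < ⋯ < t_K = +∞` and representatives `0 < μ₁ < ⋯ < μ_K`
(here `rep k` is the representative of the bin `[t k, t (k + 1))`, `k = 0, …, K - 1`). -/
structure Quantizer (b : ℕ) where
  t : Fin (2 ^ (b - 1) + 1) → EReal
  t_strictMono : StrictMono t
  t_zero : t 0 = 0
  t_last : t (Fin.last _) = ⊤
  rep : Fin (2 ^ (b - 1)) → ℝ
  rep_pos : ∀ k, 0 < rep k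
  rep_strictMono : StrictMono rep

/-- The `k`-th bin `[t k, t (k + 1))` of the positive half-line. -/
def Quantizer.bin {b : ℕ} (q : Quantizer b) (k : Fin (2 ^ (b - 1))) : Set ℝ :=
  {r : ℝ | q.t k.castSucc ≤ (r : EReal) ∧ (r : EReal) < q.t k.succ}

/-- The quantization map `Q(z) = sign(z) ∑ₖ μₖ 1(|z| ∈ Rₖ)`. -/
def Quantizer.map {b : ℕ} (q : Quantizer b) (z : ℝ) : ℝ :=
  Real.sign z * ∑ k, (q.bin k).indicator (fun _ => q.rep k) |z|

/-! ### The constants `λ` and `Ψ`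

In the measurement model, `y = Q(⟨a, x⟩ + σ ε)` where `⟨a, x⟩` is centred Gaussian with standard
deviation `ψ`, so `⟨a, x⟩ = ψ g` with `g ∼ N(0, 1)` independent of `ε ∼ N(0, 1)`. -/

/-- `θ(u) = E[y | ⟨a, x⟩ = ψ u]`. -/
def theta {b : ℕ} (q : Quantizer b) (σ ψ u : ℝ) : ℝ :=
  ∫ e, q.map (ψ * u + σ * e) ∂(gaussianReal 0 1)

/-- `λ = E[θ(g) g]`, `g ∼ N(0, 1)`. -/
def lam {b : ℕ} (q : Quantizer b) (σ ψ : ℝ) : ℝ :=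
  ∫ g, theta q σ ψ g * g ∂(gaussianReal 0 1)

/-- `Ψ = √(E[y²])`. -/
def Psi {b : ℕ} (q : Quantizer b) (σ ψ : ℝ) : ℝ :=
  √(∫ p : ℝ × ℝ, (q.map (ψ * p.1 + σ * p.2)) ^ 2 ∂((gaussianReal 0 1).prod (gaussianReal 0 1)))

/-! ### Geometry -/

/-- The direction `x / ‖x‖₂`. -/
def direction {n : ℕ} (x : E n) : E n := ‖x‖⁻¹ • x

/-- The constraint set `C = K ∩ B₂ⁿ`. -/
def constraint {n : ℕ} (K : Set (E n)) : Set (E n) := K ∩ Metric.closedBall 0 1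

/-- The tangent cone `{α (x - x₀) : α ≥ 0, x ∈ C}` of `C` at `x₀`. -/
def tangentCone {n : ℕ} (C : Set (E n)) (x₀ : E n) : Set (E n) :=
  {v | ∃ α : ℝ, 0 ≤ α ∧ ∃ x ∈ C, v = α • (x - x₀)}

/-- The spherical part of the tangent cone. -/
def sphericalPart {n : ℕ} (C : Set (E n)) (x₀ : E n) : Set (E n) :=
  tangentCone C x₀ ∩ Metric.sphere 0 1

/-- The Gaussian width `E sup_{v ∈ T} |⟨g, v⟩|`, `g ∼ N(0, Iₙ)`, of a bounded set `T`
(it is `0` for `T = ∅`). -/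
def gaussianWidth {n : ℕ} (T : Set (E n)) : ℝ :=
  ∫ g, (⨆ v : T, |⟪g, (v : E n)⟫|) ∂(stdGaussian (E n))

/-- The condition number `‖M‖ ‖M⁻¹‖` (spectral norms) of a matrix. -/
def condNumber {n : ℕ} (M : Matrix (Fin n) (Fin n) ℝ) : ℝ :=
  ‖Matrix.toEuclideanCLM (𝕜 := ℝ) M‖ * ‖Matrix.toEuclideanCLM (𝕜 := ℝ) M⁻¹‖

/-- `‖S^{1/2} x‖₂`, the standard deviation of `⟨a, x⟩` for `a ∼ N(0, S)`. -/
def scale {n : ℕ} (S : Matrix (Fin n) (Fin n) ℝ) (x : E n) : ℝ :=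
  ‖Matrix.toEuclideanCLM (𝕜 := ℝ) (CFC.sqrt S) x‖

/-! ### Measurements and the estimator -/

/-- Measurement vectors `aᵢ ∼ N(0, S)` and noise `εᵢ ∼ N(0, 1)`, `i = 1, …, m`, all independent. -/
structure IsDesign {n m : ℕ} (S : Matrix (Fin n) (Fin n) ℝ) {Ω : Type*} [MeasurableSpace Ω]
    (P : Measure Ω) (a : Fin m → Ω → E n) (ε : Fin m → Ω → ℝ) : Prop where
  measurable_a : ∀ i, Measurable (a i)
  measurable_ε : ∀ i, Measurable (ε i)
  law_a : ∀ i, P.map (a i) = multivariateGaussian 0 S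
  law_ε : ∀ i, P.map (ε i) = gaussianReal 0 1
  indep_a_ε : ∀ i, IndepFun (a i) (ε i) P
  iIndep : iIndepFun (fun i ω => (a i ω, ε i ω)) P

/-- The quantized observation `yᵢ = Q(⟨aᵢ, x⟩ + σ εᵢ)`. -/
def observation {b n m : ℕ} (q : Quantizer b) (σ : ℝ) (x : E n) {Ω : Type*}
    (a : Fin m → Ω → E n) (ε : Fin m → Ω → ℝ) (i : Fin m) (ω : Ω) : ℝ :=
  q.map (⟪a i ω, x⟫ + σ * ε i ω)

/-- `η = Aᵀ y / m = (1 / m) ∑ᵢ yᵢ aᵢ`. -/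
def eta {b n m : ℕ} (q : Quantizer b) (σ : ℝ) (x : E n) {Ω : Type*}
    (a : Fin m → Ω → E n) (ε : Fin m → Ω → ℝ) (ω : Ω) : E n :=
  (m : ℝ)⁻¹ • ∑ i, observation q σ x a ε i ω • a i ω

/-- `xhat ∈ argmin_{x ∈ C} - ⟨x, S⁻¹ η⟩`. -/
def IsEstimate {n : ℕ} (S : Matrix (Fin n) (Fin n) ℝ) (C : Set (E n)) (η xhat : E n) : Prop :=
  xhat ∈ C ∧ IsMinOn (fun x => -⟪x, Matrix.toEuclideanCLM (𝕜 := ℝ) S⁻¹ η⟫) C xhat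

/-- With probability at least `p`, every minimizer `xhat` satisfies
`‖xhat - x / ‖x‖‖ ≤ 24 κ(S^{1/2}) (Ψ / λ) w / √m`, where `w` is the Gaussian width of the spherical
part of the tangent cone of `C = K ∩ B₂ⁿ` at `x / ‖x‖`. -/
def ErrorBoundWithProb {b n m : ℕ} (q : Quantizer b) (σ : ℝ) (S : Matrix (Fin n) (Fin n) ℝ)
    (K : Set (E n)) (x : E n) {Ω : Type*} [MeasurableSpace Ω] (P : Measure Ω)
    (a : Fin m → Ω → E n) (ε : Fin m → Ω → ℝ) (p : ℝ) : Prop :=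
  ∃ G : Set Ω, MeasurableSet G ∧ p ≤ P.real G ∧
    ∀ ω ∈ G, ∀ xhat : E n, IsEstimate S (constraint K) (eta q σ x a ε ω) xhat →
      ‖xhat - direction x‖ ≤
        24 * condNumber (CFC.sqrt S) * (Psi q σ (scale S x) / lam q σ (scale S x)) *
          (gaussianWidth (sphericalPart (constraint K) (direction x)) / √(m : ℝ))

end QuantizedRecovery

end

/-! Write `S = Σ`, `R = Σ^{1/2}`, `J = Σ^{-1/2}`, `aᵢ = R gᵢ` and `u = R x / ψ`. Then `yᵢ = Q(ψ⟨u,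
gᵢ⟩ + σ εᵢ)`, with argument `r zᵢ`, where `r = √(ψ² + σ²)` and `zᵢ` is standard normal. An
orthogonal reflection of `(gᵢ, εᵢ)` in the plane of `u` and the noise axis gives new coordinates
`(kᵢ, zᵢ)`, with `kᵢ` a standard Gaussian vector independent of `zᵢ`, and `gᵢ = B kᵢ + ρ zᵢ u`,
where `ρ = ψ / r` and `‖B‖ ≤ 1`. As `J u = x / ψ`, this splits `Σ⁻¹ η` exactly (`inv_apply_eta`)
into a positive multiple of `x`, governed by `∑ yᵢ zᵢ`, and the error `m⁻¹ J B ∑ yᵢ kᵢ`.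

Given the `zᵢ`, the error is `√(∑ yᵢ²) / m` times the image under `J B` of one standard Gaussian
vector. Its supremum over the spherical part has mean at most `‖J‖ w`
(`integral_seminorm_comp_le_of_contraction`) before scaling, and Gaussian concentration
(`measureReal_ge_le_of_lipschitz`) bounds it by `2‖J‖ w` up to probability `exp(-w²/5)`. Chernoff
bounds give `∑ yᵢ zᵢ > m l / 2`, with `λ = ρ l`, and `∑ yᵢ² < 9 m Ψ²` up to `exp(-cm)` each.

A minimizer is then controlled by the curvature of the unit ball (`mul_norm_sub_direction_le`). The
constant is `24 = 2 · 3 · 2 · 2`: curvature, `√9`, concentration, half mean. The factor `‖R‖`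
completing `κ` comes from `ψ ≤ ‖R‖ ‖x‖`. -/

namespace QuantizedRecovery

/-! ### Gaussian concentration by the Maurey–Pisier rotation argument. -/

section GaussianConcentration

variable {V : Type*} [NormedAddCommGroup V] [InnerProductSpace ℝ V] [FiniteDimensional ℝ V]
  [MeasurableSpace V] [BorelSpace V]

lemma lintegral_exp_dual_stdGaussian (L : StrongDual ℝ V) :
    ∫⁻ y, ENNReal.ofReal (Real.exp (L y)) ∂(stdGaussian V)
      = ENNReal.ofReal (Real.exp (‖L‖ ^ 2 / 2)) := by
  have hmap : (stdGaussian V).map L = gaussianReal 0 (‖L‖ ^ 2).toNNReal := by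
    rw [IsGaussian.map_eq_gaussianReal, integral_strongDual_stdGaussian, variance_dual_stdGaussian]
  have h1 : ∫⁻ y, ENNReal.ofReal (Real.exp (L y)) ∂(stdGaussian V)
      = ∫⁻ z, ENNReal.ofReal (Real.exp z) ∂(gaussianReal 0 (‖L‖ ^ 2).toNNReal) := by
    rw [← hmap, lintegral_map (by fun_prop) (by fun_prop)]
  rw [h1, ← ofReal_integral_eq_lintegral_ofReal]
  · have := congrFun (mgf_fun_id_gaussianReal (μ := 0) (v := (‖L‖ ^ 2).toNNReal)) 1
    simp only [mgf, one_mul] at this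
    rw [this]
    simp
  · have := integrable_exp_mul_gaussianReal (μ := 0) (v := (‖L‖ ^ 2).toNNReal) 1
    simpa using this
  · exact Eventually.of_forall fun _ => (Real.exp_pos _).le

lemma integrable_of_lipschitz {μ : Measure V} [IsGaussian μ] {L : NNReal} {f : V → ℝ}
    (hf : LipschitzWith L f) : Integrable f μ := by
  have h : Integrable (fun x => ‖f 0‖ + L * ‖x‖) μ :=
    (integrable_const _).add ((IsGaussian.integrable_id.norm).const_mul _)
  refine h.mono' hf.continuous.aestronglyMeasurable (Eventually.of_forall fun x => ?_)
  have := hf.dist_le_mul x 0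
  rw [dist_zero_right, Real.dist_eq] at this
  have h2 := norm_add_le (f x - f 0) (f 0)
  simp only [sub_add_cancel, Real.norm_eq_abs] at h2 ⊢
  linarith

/-- Jensen's inequality for `exp` of an integral over a quarter turn. -/
lemma ofReal_exp_intervalIntegral_le {g : ℝ → ℝ} (hg : Continuous g) :
    ENNReal.ofReal (Real.exp (∫ θ in (0 : ℝ)..(Real.pi / 2), g θ)) ≤
      ENNReal.ofReal (2 / Real.pi) *
        ∫⁻ θ in Set.Ioc (0 : ℝ) (Real.pi / 2),
          ENNReal.ofReal (Real.exp (Real.pi / 2 * g θ)) := by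
  have hpi := Real.pi_pos
  have hle : (0 : ℝ) ≤ Real.pi / 2 := by positivity
  have hvol : (volume.real (Set.Ioc (0 : ℝ) (Real.pi / 2))) = Real.pi / 2 := by
    simp [Measure.real, hle]
  have key := convexOn_exp.map_set_average_le Real.continuous_exp.continuousOn isClosed_univ
    (μ := volume) (t := Set.Ioc (0 : ℝ) (Real.pi / 2)) (f := fun θ => Real.pi / 2 * g θ)
    (by simp [hpi]) (by simp) (by simp)
    ((by fun_prop : Continuous fun θ => Real.pi / 2 * g θ).integrableOn_Ioc)
    ((by fun_prop : Continuous (Real.exp ∘ fun θ => Real.pi / 2 * g θ)).integrableOn_Ioc)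
  rw [setAverage_eq, setAverage_eq, hvol, integral_const_mul] at key
  rw [intervalIntegral.integral_of_le hle, ← ofReal_integral_eq_lintegral_ofReal
    ((by fun_prop : Continuous fun θ => Real.exp (Real.pi / 2 * g θ)).integrableOn_Ioc)
    (Eventually.of_forall fun _ => (Real.exp_pos _).le), ← ENNReal.ofReal_mul (by positivity)]
  apply ENNReal.ofReal_le_ofReal
  simp only [smul_eq_mul] at key
  rw [← mul_assoc, inv_mul_cancel₀ (by positivity), one_mul, inv_div] at key
  exact key

/-- The rotated point and its velocity are again independent standard Gaussians. Given the point,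
the derivative is a centred Gaussian of standard deviation at most `L`. -/
lemma lintegral_exp_fderiv_rotation_le {L : NNReal} {f : V → ℝ} (hf : ContDiff ℝ 1 f)
    (hL : LipschitzWith L f) (s θ : ℝ) :
    ∫⁻ p, ENNReal.ofReal (Real.exp (Real.pi / 2 * (s * fderiv ℝ f
        (Real.cos θ • p.1 + Real.sin θ • p.2) (-Real.sin θ • p.1 + Real.cos θ • p.2))))
        ∂((stdGaussian V).prod (stdGaussian V)) ≤
      ENNReal.ofReal (Real.exp (s ^ 2 * Real.pi ^ 2 * L ^ 2 / 8)) := by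
  have hfd : Continuous (fderiv ℝ f) := hf.continuous_fderiv one_ne_zero
  have hrot := IsGaussian.map_rotation_eq_self (μ := stdGaussian V) (by simp) θ
  have hmeas : Measurable (fun q : V × V =>
      ENNReal.ofReal (Real.exp (Real.pi / 2 * (s * fderiv ℝ f q.1 q.2)))) := by
    have : Continuous (fun q : V × V => fderiv ℝ f q.1 q.2) :=
      (hfd.comp continuous_fst).clm_apply continuous_snd
    have := this.measurable
    fun_prop
  calc _
      = ∫⁻ q, ENNReal.ofReal (Real.exp (Real.pi / 2 * (s * fderiv ℝ f q.1 q.2)))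
        ∂(((stdGaussian V).prod (stdGaussian V)).map (ContinuousLinearMap.rotation θ)) := by
        rw [lintegral_map hmeas (by fun_prop)]
        simp [ContinuousLinearMap.rotation_apply]
    _ = ∫⁻ x, ∫⁻ y, ENNReal.ofReal (Real.exp (Real.pi / 2 * (s * fderiv ℝ f x y)))
        ∂(stdGaussian V) ∂(stdGaussian V) := by
        rw [hrot, lintegral_prod _ hmeas.aemeasurable]
    _ ≤ ∫⁻ x, ENNReal.ofReal (Real.exp (s ^ 2 * Real.pi ^ 2 * L ^ 2 / 8)) ∂(stdGaussian V) := by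
        refine lintegral_mono fun x => ?_
        have := lintegral_exp_dual_stdGaussian ((Real.pi / 2 * s) • fderiv ℝ f x)
        simp only [smul_apply, smul_eq_mul, mul_assoc] at this
        rw [this]
        apply ENNReal.ofReal_le_ofReal
        apply Real.exp_le_exp.2
        have hn : ‖fderiv ℝ f x‖ ≤ L := norm_fderiv_le_of_lipschitz ℝ hL
        have hn2 : ‖fderiv ℝ f x‖ ^ 2 ≤ (L : ℝ) ^ 2 := by gcongr
        rw [norm_smul, mul_pow, norm_mul, mul_pow, Real.norm_eq_abs, Real.norm_eq_abs, sq_abs,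
          sq_abs]
        nlinarith [mul_nonneg (sq_nonneg (Real.pi * s)) (sub_nonneg.2 hn2)]
    _ = _ := by simp

/-- The quarter circle `cos θ • x + sin θ • y` joins two independent copies. Integrate the
derivative of `f` along it, apply Jensen in `θ`, and bound each angle separately. -/
lemma lintegral_exp_sub_le {L : NNReal} {f : V → ℝ} (hf : ContDiff ℝ 1 f)
    (hL : LipschitzWith L f) (s : ℝ) :
    ∫⁻ p, ENNReal.ofReal (Real.exp (s * (f p.2 - f p.1)))
        ∂((stdGaussian V).prod (stdGaussian V)) ≤
      ENNReal.ofReal (Real.exp (s ^ 2 * Real.pi ^ 2 * L ^ 2 / 8)) := by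
  have hpi := Real.pi_pos
  obtain ⟨D, hD⟩ : ∃ D : V × V → ℝ → ℝ, ∀ p θ, D p θ = fderiv ℝ f
      (Real.cos θ • p.1 + Real.sin θ • p.2) (-Real.sin θ • p.1 + Real.cos θ • p.2) :=
    ⟨_, fun _ _ => rfl⟩
  have hfd : Continuous (fderiv ℝ f) := hf.continuous_fderiv one_ne_zero
  have hDc : Continuous (fun q : (V × V) × ℝ => D q.1 q.2) := by
    simp only [hD]
    exact (hfd.comp (by fun_prop)).clm_apply (by fun_prop)
  have hDp (p : V × V) : Continuous (D p) := hDc.comp (Continuous.prodMk_right p)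
  have hftc : ∀ p : V × V, f p.2 - f p.1 = ∫ θ in (0 : ℝ)..(Real.pi / 2), D p θ := by
    intro p
    have hder : ∀ θ : ℝ, HasDerivAt (fun θ => f (Real.cos θ • p.1 + Real.sin θ • p.2)) (D p θ) θ := by
      intro θ
      have h1 : HasDerivAt (fun θ : ℝ => Real.cos θ • p.1 + Real.sin θ • p.2)
          (-Real.sin θ • p.1 + Real.cos θ • p.2) θ :=
        ((Real.hasDerivAt_cos θ).smul_const _).add ((Real.hasDerivAt_sin θ).smul_const _)
      rw [hD]
      exact ((hf.differentiable one_ne_zero _).hasFDerivAt).comp_hasDerivAt θ h1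
    rw [intervalIntegral.integral_eq_sub_of_hasDerivAt (fun θ _ => hder θ)
      ((hDp p).intervalIntegrable _ _)]
    simp
  have hbound : ∀ θ : ℝ, ∫⁻ p, ENNReal.ofReal (Real.exp (Real.pi / 2 * (s * D p θ)))
        ∂((stdGaussian V).prod (stdGaussian V)) ≤
      ENNReal.ofReal (Real.exp (s ^ 2 * Real.pi ^ 2 * L ^ 2 / 8)) := by
    intro θ
    simp only [hD]
    exact lintegral_exp_fderiv_rotation_le hf hL s θ
  have hDm : Measurable (fun q : (V × V) × ℝ =>
      ENNReal.ofReal (Real.exp (Real.pi / 2 * (s * D q.1 q.2)))) := by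
    have := hDc.measurable
    fun_prop
  calc ∫⁻ p, ENNReal.ofReal (Real.exp (s * (f p.2 - f p.1)))
        ∂((stdGaussian V).prod (stdGaussian V))
      ≤ ∫⁻ p, ENNReal.ofReal (2 / Real.pi) * (∫⁻ θ in Set.Ioc (0 : ℝ) (Real.pi / 2),
          ENNReal.ofReal (Real.exp (Real.pi / 2 * (s * D p θ))))
          ∂((stdGaussian V).prod (stdGaussian V)) := by
        refine lintegral_mono fun p => ?_
        have := ofReal_exp_intervalIntegral_le (g := fun θ => s * D p θ)
          (continuous_const.mul (hDp p))
        rw [intervalIntegral.integral_const_mul, ← hftc] at this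
        exact this
    _ = ENNReal.ofReal (2 / Real.pi) * ∫⁻ θ in Set.Ioc (0 : ℝ) (Real.pi / 2),
          ∫⁻ p, ENNReal.ofReal (Real.exp (Real.pi / 2 * (s * D p θ)))
          ∂((stdGaussian V).prod (stdGaussian V)) := by
        rw [lintegral_const_mul' _ _ (by simp), lintegral_lintegral_swap hDm.aemeasurable]
    _ ≤ ENNReal.ofReal (2 / Real.pi) * ∫⁻ θ in Set.Ioc (0 : ℝ) (Real.pi / 2),
          ENNReal.ofReal (Real.exp (s ^ 2 * Real.pi ^ 2 * L ^ 2 / 8)) := by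
        gcongr with θ
        exact hbound θ
    _ = _ := by
        rw [setLIntegral_const, Real.volume_Ioc, mul_left_comm, sub_zero,
          ← ENNReal.ofReal_mul (by positivity)]
        have : 2 / Real.pi * (Real.pi / 2) = 1 := by field_simp
        rw [this]; simp

/-- By Jensen, replacing the independent copy by its mean only lowers the exponential moment. -/
lemma lintegral_exp_sub_integral_le {L : NNReal} {f : V → ℝ} (hf : ContDiff ℝ 1 f)
    (hL : LipschitzWith L f) (s : ℝ) :
    ∫⁻ x, ENNReal.ofReal (Real.exp (s * (f x - ∫ y, f y ∂(stdGaussian V)))) ∂(stdGaussian V) ≤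
      ENNReal.ofReal (Real.exp (s ^ 2 * Real.pi ^ 2 * L ^ 2 / 8)) := by
  have hfm := hf.continuous.measurable
  have hint := integrable_of_lipschitz (μ := stdGaussian V) hL
  have hm : Measurable (fun p : V × V => ENNReal.ofReal (Real.exp (s * (f p.2 - f p.1)))) := by
    fun_prop
  refine le_trans ?_ (lintegral_exp_sub_le hf hL s)
  rw [lintegral_prod_symm _ hm.aemeasurable]
  refine lintegral_mono fun x => ?_
  by_cases hi : Integrable (fun y => Real.exp (s * (f x - f y))) (stdGaussian V)
  · rw [← ofReal_integral_eq_lintegral_ofReal hi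
      (Eventually.of_forall fun _ => (Real.exp_pos _).le)]
    apply ENNReal.ofReal_le_ofReal
    have hi1 : Integrable (fun y => s * (f x - f y)) (stdGaussian V) :=
      ((integrable_const _).sub hint).const_mul _
    have := convexOn_exp.map_integral_le Real.continuous_exp.continuousOn isClosed_univ
      (by simp) hi1 hi
    rwa [integral_const_mul, integral_sub (integrable_const _) hint, integral_const,
      probReal_univ, one_smul] at this
  · have : ∫⁻ y, ENNReal.ofReal (Real.exp (s * (f x - f y))) ∂(stdGaussian V) = ⊤ := by
      by_contra h
      exact hi ((lintegral_ofReal_ne_top_iff_integrable (by fun_prop)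
        (Eventually.of_forall fun _ => (Real.exp_pos _).le)).1 h)
    simp only [this, le_top]

lemma measureReal_ge_le_of_contDiff {L : NNReal} {f : V → ℝ} (hf : ContDiff ℝ 1 f)
    (hL : LipschitzWith L f) {s : ℝ} (hs : 0 ≤ s) (t : ℝ) :
    (stdGaussian V).real {x | t ≤ f x - ∫ y, f y ∂(stdGaussian V)} ≤
      Real.exp (s ^ 2 * Real.pi ^ 2 * L ^ 2 / 8 - s * t) := by
  have hfm := hf.continuous.measurable
  have h1 := (mul_meas_ge_le_lintegral (μ := stdGaussian V)
    (f := fun x => ENNReal.ofReal (Real.exp (s * (f x - ∫ y, f y ∂(stdGaussian V)))))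
    (by fun_prop) (ENNReal.ofReal (Real.exp (s * t)))).trans
    (lintegral_exp_sub_integral_le hf hL s)
  have h2 : (stdGaussian V) {x | t ≤ f x - ∫ y, f y ∂(stdGaussian V)} ≤
      (stdGaussian V) {x | ENNReal.ofReal (Real.exp (s * t)) ≤
        ENNReal.ofReal (Real.exp (s * (f x - ∫ y, f y ∂(stdGaussian V))))} := by
    refine measure_mono fun x hx => ENNReal.ofReal_le_ofReal (Real.exp_le_exp.2 ?_)
    exact mul_le_mul_of_nonneg_left hx hs
  have h3 : ENNReal.ofReal (Real.exp (s * t)) *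
      (stdGaussian V) {x | t ≤ f x - ∫ y, f y ∂(stdGaussian V)} ≤
      ENNReal.ofReal (Real.exp (s ^ 2 * Real.pi ^ 2 * L ^ 2 / 8)) :=
    (by gcongr : _ ≤ _).trans h1
  have h4 := ENNReal.toReal_mono (by simp) h3
  rw [ENNReal.toReal_mul, ENNReal.toReal_ofReal (Real.exp_pos _).le,
    ENNReal.toReal_ofReal (Real.exp_pos _).le] at h4
  rw [Real.exp_sub, le_div_iff₀ (Real.exp_pos _), mul_comm]
  exact h4

/-- A Lipschitz function is a uniform limit of smooth functions with the same Lipschitz constant. -/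
lemma exists_contDiff_lipschitz_approx {L : NNReal} {f : V → ℝ} (hf : LipschitzWith L f) {δ : ℝ}
    (hδ : 0 < δ) :
    ∃ h : V → ℝ, ContDiff ℝ 1 h ∧ LipschitzWith L h ∧ ∀ x, |h x - f x| ≤ L * δ := by
  -- Mollification by a bump supported in the `δ`-ball: averaging translates keeps the Lipschitz
  -- constant and moves values by at most `L δ`.
  let φ : ContDiffBump (0 : V) := ⟨δ / 2, δ, by positivity, by linarith⟩
  let μ : Measure V := Measure.addHaar
  have hloc : LocallyIntegrable f μ := hf.continuous.locallyIntegrable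
  have hconv : ∀ x, Integrable (fun t => φ.normed μ t • f (x - t)) μ := by
    intro x
    have := ((φ.hasCompactSupport_normed (μ := μ)).convolutionExists_left (ContinuousLinearMap.lsmul ℝ ℝ)
      φ.continuous_normed hloc) x
    exact this
  refine ⟨convolution (φ.normed μ) f (ContinuousLinearMap.lsmul ℝ ℝ) μ, ?_, ?_, ?_⟩
  · exact (φ.hasCompactSupport_normed (μ := μ)).contDiff_convolution_left (n := 1) _
      φ.contDiff_normed hloc
  · refine LipschitzWith.of_dist_le_mul fun x y => ?_
    rw [convolution_def, convolution_def, Real.dist_eq]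
    simp only [ContinuousLinearMap.lsmul_apply]
    rw [← integral_sub (hconv x) (hconv y)]
    have hb : ∀ t, ‖φ.normed μ t • f (x - t) - φ.normed μ t • f (y - t)‖ ≤
        φ.normed μ t * (L * dist x y) := by
      intro t
      rw [← smul_sub, norm_smul, Real.norm_of_nonneg (φ.nonneg_normed t)]
      refine mul_le_mul_of_nonneg_left ?_ (φ.nonneg_normed t)
      have := hf.dist_le_mul (x - t) (y - t)
      rwa [dist_sub_right, dist_eq_norm] at this
    have := norm_integral_le_of_norm_le (φ.integrable_normed.mul_const (L * dist x y))
      (Eventually.of_forall hb)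
    rwa [integral_mul_const, φ.integral_normed, one_mul] at this
  · intro x
    have := φ.dist_normed_convolution_le (μ := μ) (g := f) (x₀ := x) (ε := L * δ)
      hf.continuous.aestronglyMeasurable (fun y hy => ?_)
    · rwa [Real.dist_eq] at this
    · exact (hf.dist_le_mul y x).trans
        (mul_le_mul_of_nonneg_left (Metric.mem_ball.1 hy).le L.coe_nonneg)

/-- **Gaussian concentration** for Lipschitz functions. -/
theorem measureReal_ge_le_of_lipschitz {L : NNReal} {f : V → ℝ} (hf : LipschitzWith L f)
    (hL : 0 < L) {t : ℝ} (ht : 0 ≤ t) :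
    (stdGaussian V).real {x | L * t ≤ f x - ∫ y, f y ∂(stdGaussian V)} ≤
      Real.exp (-(t ^ 2 / 5)) := by
  have hL' : (0 : ℝ) < L := hL
  -- This minimizes `s² π² L² / 8 - s L t` once `π²` is replaced by `10`; the minimum is `-t² / 5`.
  set s : ℝ := 4 * t / (10 * L) with hs
  have hs0 : 0 ≤ s := by positivity
  have hδ : ∀ δ : ℝ, 0 < δ →
      (stdGaussian V).real {x | L * t ≤ f x - ∫ y, f y ∂(stdGaussian V)} ≤
        Real.exp (s ^ 2 * Real.pi ^ 2 * L ^ 2 / 8 - s * (L * t - 2 * (L * δ))) := by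
    intro δ hδ
    obtain ⟨h, hc, hhL, hfh⟩ := exists_contDiff_lipschitz_approx hf hδ
    refine le_trans (measureReal_mono fun x hx => ?_)
      (measureReal_ge_le_of_contDiff hc hhL hs0 _)
    have hE : |∫ y, h y ∂(stdGaussian V) - ∫ y, f y ∂(stdGaussian V)| ≤ L * δ := by
      rw [← integral_sub (integrable_of_lipschitz hhL) (integrable_of_lipschitz hf)]
      have := norm_integral_le_of_norm_le (μ := stdGaussian V) (integrable_const (L * δ))
        (f := fun y => h y - f y) (Eventually.of_forall fun y => hfh y)
      simpa using this
    have h1 := abs_le.1 (hfh x)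
    have h2 := abs_le.1 hE
    simp only [Set.mem_ofPred_eq] at hx ⊢
    linarith
  have hlim : Tendsto (fun δ : ℝ =>
      Real.exp (s ^ 2 * Real.pi ^ 2 * L ^ 2 / 8 - s * (L * t - 2 * (L * δ)))) (𝓝[>] 0)
      (𝓝 (Real.exp (s ^ 2 * Real.pi ^ 2 * L ^ 2 / 8 - s * (L * t - 2 * (L * 0))))) :=
    tendsto_nhdsWithin_of_tendsto_nhds (Continuous.tendsto (by fun_prop) 0)
  refine (ge_of_tendsto hlim (eventually_nhdsWithin_of_forall hδ)).trans
    (Real.exp_le_exp.2 ?_)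
  have e1 : s * L = 2 / 5 * t := by rw [hs]; field_simp; ring
  have e2 : s ^ 2 * Real.pi ^ 2 * L ^ 2 = (s * L) ^ 2 * Real.pi ^ 2 := by ring
  have e3 : s * (L * t - 2 * (L * 0)) = (s * L) * t := by ring
  rw [e2, e3, e1]
  have hp : Real.pi ^ 2 ≤ 10 := by nlinarith [Real.pi_lt_d2, Real.pi_gt_three]
  nlinarith [mul_nonneg (sq_nonneg t) (sub_nonneg.2 hp)]

end GaussianConcentration

/-! ### Invariances of Gaussian measures and tails of independent sums. -/

section GaussianLaws

variable {V : Type*} [NormedAddCommGroup V] [InnerProductSpace ℝ V] [FiniteDimensional ℝ V]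
  [MeasurableSpace V] [BorelSpace V]

lemma stdGaussian_real : stdGaussian ℝ = gaussianReal 0 1 := by
  refine Measure.ext_of_charFun (funext fun t => ?_)
  rw [charFun_stdGaussian, charFun_gaussianReal, ← Complex.ofReal_pow, Real.norm_eq_abs, sq_abs]
  simp [neg_div]

/-- A linear map of `V × ℝ` acting on the plane spanned by `u` and the last coordinate; it is a
reflection if `u` is a unit vector and `ρ ^ 2 + τ ^ 2 = 1`. -/
def planeReflection (u : V) (ρ τ : ℝ) (p : V × ℝ) : V × ℝ :=
  ((p.1 - ((1 + τ) * ⟪u, p.1⟫) • u) + (ρ * p.2) • u, τ * p.2 + ρ * ⟪u, p.1⟫)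

/-- The standard Gaussian measure on `V × ℝ` is invariant under `planeReflection`. -/
lemma measurePreserving_planeReflection {u : V} (hu : ‖u‖ = 1) {ρ τ : ℝ}
    (h : ρ ^ 2 + τ ^ 2 = 1) :
    MeasurePreserving (planeReflection u ρ τ)
      ((stdGaussian V).prod (gaussianReal 0 1)) ((stdGaussian V).prod (gaussianReal 0 1)) := by
  rw [← stdGaussian_real]
  refine ⟨by unfold planeReflection; fun_prop, ?_⟩
  let T : V × ℝ →L[ℝ] V × ℝ :=
    ((ContinuousLinearMap.fst ℝ V ℝ -
        (((1 + τ) • innerSL ℝ u).comp (ContinuousLinearMap.fst ℝ V ℝ)).smulRight u) +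
      (ρ • ContinuousLinearMap.snd ℝ V ℝ).smulRight u).prod
    (τ • ContinuousLinearMap.snd ℝ V ℝ +
      (ρ • innerSL ℝ u).comp (ContinuousLinearMap.fst ℝ V ℝ))
  have hT : planeReflection u ρ τ = T := by
    ext p <;> simp [T, planeReflection]
  rw [hT]
  refine Measure.ext_of_charFunDual (funext fun L => ?_)
  rw [charFunDual_map, charFunDual_prod, charFunDual_prod]
  simp only [charFunDual_stdGaussian]
  rw [← Complex.exp_add, ← Complex.exp_add]
  obtain ⟨a, ha⟩ : ∃ a : V, ∀ k, L (k, 0) = ⟪a, k⟫ :=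
    ⟨(InnerProductSpace.toDual ℝ V).symm (L.comp (ContinuousLinearMap.inl ℝ V ℝ)), by simp⟩
  set c : ℝ := L (0, 1) with hc
  have hL : ∀ k z, L (k, z) = ⟪a, k⟫ + z * c := by
    intro k z
    have : ((k, z) : V × ℝ) = (k, 0) + z • (0, 1) := by simp
    rw [this, map_add, map_smul, ha, smul_eq_mul]
  set α : ℝ := ⟪a, u⟫ with hα
  have e1 : (L.comp T).comp (ContinuousLinearMap.inl ℝ V ℝ) =
      innerSL ℝ (a + (c * ρ - (1 + τ) * α) • u) := by
    ext k
    simp [T, hL, inner_sub_right, inner_smul_right, ← hα]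
    ring
  have e2 : (L.comp T).comp (ContinuousLinearMap.inr ℝ V ℝ) = innerSL ℝ (ρ * α + c * τ) := by
    ext
    simp [T, hL, inner_smul_right, ← hα]
    ring
  have e3 : L.comp (ContinuousLinearMap.inl ℝ V ℝ) = innerSL ℝ a := by
    ext k; simp [hL]
  have e4 : L.comp (ContinuousLinearMap.inr ℝ V ℝ) = innerSL ℝ c := by
    ext; simp [hL]
  rw [e1, e2, e3, e4]
  simp only [innerSL_apply_norm]
  -- Orthogonality of the reflection: pulling a functional back preserves the sum of its squared
  -- coefficients, hence the characteristic function.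
  have key : ‖a + (c * ρ - (1 + τ) * α) • u‖ ^ 2 + ‖ρ * α + c * τ‖ ^ 2 = ‖a‖ ^ 2 + ‖c‖ ^ 2 := by
    rw [norm_add_sq_real, norm_smul, hu, inner_smul_right, ← hα, mul_one]
    simp only [Real.norm_eq_abs, sq_abs]
    linear_combination (α ^ 2 + c ^ 2) * h
  congr 1
  have key' := congrArg (fun x : ℝ => (x : ℂ)) key
  push_cast at key'
  linear_combination (-1 / 2 : ℂ) * key'

/-- A linear combination of independent standard Gaussian vectors. -/
lemma map_sum_smul_stdGaussian {m : ℕ} (y : Fin m → ℝ) :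
    (Measure.pi fun _ : Fin m => stdGaussian V).map (fun k => ∑ i, y i • k i) =
      (stdGaussian V).map (fun k => √(∑ i, y i ^ 2) • k) := by
  let T : (Fin m → V) →L[ℝ] V := ∑ i, y i • ContinuousLinearMap.proj i
  have hT : (fun k : Fin m → V => ∑ i, y i • k i) = T := by
    ext k; simp [T]
  have hs : (fun k : V => √(∑ i, y i ^ 2) • k) =
    (√(∑ i, y i ^ 2) • ContinuousLinearMap.id ℝ V : V →L[ℝ] V) := by
    ext k; simp
  rw [hT, hs]
  refine Measure.ext_of_charFunDual (funext fun L => ?_)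
  rw [charFunDual_map, charFunDual_map, charFunDual_pi]
  simp only [charFunDual_stdGaussian]
  have e1 : ∀ i, (L.comp T).comp (ContinuousLinearMap.single ℝ (fun _ : Fin m => V) i) =
      y i • L := by
    intro i
    ext k
    simp [T, Pi.single_apply]
  simp only [e1]
  rw [← Complex.exp_sum]
  congr 1
  have h0 : 0 ≤ ∑ i, y i ^ 2 := Finset.sum_nonneg fun i _ => sq_nonneg _
  have e2 : L.comp (√(∑ i, y i ^ 2) • ContinuousLinearMap.id ℝ V) = √(∑ i, y i ^ 2) • L := by
    ext; simp
  have key : ∑ i, -‖y i • L‖ ^ 2 / 2 = -‖√(∑ i, y i ^ 2) • L‖ ^ 2 / 2 := by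
    simp only [norm_smul, mul_pow, Real.norm_eq_abs, sq_abs, Real.sq_sqrt h0]
    rw [← Finset.sum_div, Finset.sum_neg_distrib, Finset.sum_mul]
  rw [e2]
  exact_mod_cast key

/-- Applying a contraction does not increase the mean of a seminorm of a standard Gaussian. -/
lemma integral_seminorm_comp_le_of_contraction {n : ℕ} {L : NNReal} (p : Seminorm ℝ (E n))
    (hp : LipschitzWith L p) (A : E n →L[ℝ] E n) (hA : ‖A‖ ≤ 1) :
    ∫ k, p (A k) ∂(stdGaussian (E n)) ≤ ∫ k, p k ∂(stdGaussian (E n)) := by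
  -- `D = 1 - A A*` is the covariance missing from `A g`: adding an independent `N(0, D)` vector
  -- restores a standard Gaussian.
  let D : Matrix (Fin n) (Fin n) ℝ := (Matrix.toEuclideanCLM (𝕜 := ℝ)).symm (1 - A * A.adjoint)
  have hDinner : ∀ x : E n, x.ofLp ⬝ᵥ D.mulVec x.ofLp = ‖x‖ ^ 2 - ‖A.adjoint x‖ ^ 2 := by
    intro x
    rw [← Matrix.inner_toEuclideanCLM]
    simp only [D, StarAlgEquiv.apply_symm_apply]
    rw [sub_apply, inner_sub_right, one_apply_eq_self,
      real_inner_self_eq_norm_sq, mul_apply_eq_comp, ← A.adjoint_inner_left,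
      real_inner_self_eq_norm_sq]
  have hadj : ∀ x, ‖A.adjoint x‖ ^ 2 ≤ ‖x‖ ^ 2 := by
    intro x
    have h1 : ‖A.adjoint‖ ≤ 1 := by rwa [LinearIsometryEquiv.norm_map]
    have h2 := A.adjoint.le_of_opNorm_le h1 x
    rw [one_mul] at h2
    gcongr
  have hDpos : D.PosSemidef := by
    rw [← Matrix.isPositive_toEuclideanLin_iff, ← Matrix.coe_toEuclideanCLM_eq_toEuclideanLin,
      ContinuousLinearMap.isPositive_toLinearMap_iff]
    refine ⟨?_, fun x => ?_⟩
    · rw [← ContinuousLinearMap.isSelfAdjoint_iff_isSymmetric]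
      simp only [D, StarAlgEquiv.apply_symm_apply]
      exact (IsSelfAdjoint.one _).sub (IsSelfAdjoint.mul_star_self A)
    · rw [ContinuousLinearMap.reApplyInnerSelf_apply, real_inner_comm,
        Matrix.inner_toEuclideanCLM, hDinner]
      simpa using hadj x
  have hγ : stdGaussian (E n) = ((stdGaussian (E n)).map A) ∗ (multivariateGaussian 0 D) := by
    refine Measure.ext_of_charFun (funext fun t => ?_)
    have hA' : charFun ((stdGaussian (E n)).map A) t = charFun (stdGaussian (E n)) (A.adjoint t) := by
      rw [charFun_apply, charFun_apply, integral_map (by fun_prop) (by fun_prop)]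
      simp only [ContinuousLinearMap.adjoint_inner_right]
    rw [charFun_conv, charFun_multivariateGaussian hDpos, hDinner, hA', charFun_stdGaussian,
      charFun_stdGaussian, ← Complex.exp_add]
    congr 1
    simp
    ring
  calc ∫ k, p (A k) ∂(stdGaussian (E n)) = ∫ x, p x ∂((stdGaussian (E n)).map A) := by
        rw [integral_map (by fun_prop) hp.continuous.aestronglyMeasurable]
    _ ≤ ∫ x, ∫ y, p (x + y) ∂(multivariateGaussian 0 D) ∂((stdGaussian (E n)).map A) := by
        have hconv : Integrable p (((stdGaussian (E n)).map A) ∗ (multivariateGaussian 0 D)) := by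
          rw [← hγ]; exact integrable_of_lipschitz hp
        have hint := ((integrable_conv_iff hconv.aestronglyMeasurable).1 hconv).2
        simp only [Real.norm_of_nonneg (apply_nonneg p _)] at hint
        refine integral_mono (integrable_of_lipschitz hp) hint fun x => ?_
        have hx : LipschitzWith L (fun y => p (x + y)) :=
          LipschitzWith.of_dist_le_mul fun y z => by
            simpa using hp.dist_le_mul (x + y) (x + z)
        have hid : Integrable (fun y : E n => x + y) (multivariateGaussian 0 D) :=
          (integrable_const _).add IsGaussian.integrable_id
        -- The added vector is centred, so by Jensen averaging over it can only increase the convex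
        -- function `p`.
        have := p.convexOn.map_integral_le hp.continuous.continuousOn isClosed_univ (by simp) hid
          (integrable_of_lipschitz hx)
        rw [integral_add (integrable_const _) IsGaussian.integrable_fun_id] at this
        simpa using this
    _ = ∫ k, p k ∂(stdGaussian (E n)) := by
        rw [← integral_conv, ← hγ]
        rw [← hγ]; exact integrable_of_lipschitz hp

lemma measureReal_pi_sum_ge_le {α : Type*} [MeasurableSpace α] {μ : Measure α}
    [IsProbabilityMeasure μ] {X : α → ℝ}
    (hint : Integrable (fun z => Real.exp (X z)) μ) {b : ℝ}
    (hb : ∫ z, Real.exp (X z) ∂μ ≤ Real.exp b) (m : ℕ) (a : ℝ) :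
    (Measure.pi fun _ : Fin m => μ).real {z | a ≤ ∑ i, X (z i)} ≤ Real.exp (m * b - a) := by
  have hexp : ∀ z : Fin m → α, Real.exp (∑ i, X (z i)) = ∏ i, Real.exp (X (z i)) := fun z =>
    Real.exp_sum _ _
  have hI : Integrable (fun z : Fin m → α => Real.exp (∑ i, X (z i)))
      (Measure.pi fun _ : Fin m => μ) := by
    simp only [hexp]
    exact Integrable.fintype_prod fun _ => hint
  have h1 := mul_meas_ge_le_integral_of_nonneg
    (Eventually.of_forall fun z : Fin m → α => (Real.exp_pos (∑ i, X (z i))).le) hI (Real.exp a)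
  simp only [hexp] at h1
  rw [integral_fintype_prod_eq_prod (fun _ z => Real.exp (X z))] at h1
  simp only [← hexp, Real.exp_le_exp] at h1
  have h2 : ∏ _i : Fin m, ∫ z, Real.exp (X z) ∂μ ≤ Real.exp b ^ m := by
    rw [Finset.prod_const, Finset.card_univ, Fintype.card_fin]
    exact pow_le_pow_left₀ (integral_nonneg fun _ => (Real.exp_pos _).le) hb m
  rw [Real.exp_sub, le_div_iff₀ (Real.exp_pos _), mul_comm, Real.exp_nat_mul]
  exact h1.trans h2

/-- Lower tail of a sum of independent nonnegative variables. -/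
lemma measureReal_pi_sum_le_half_mean {α : Type*} [MeasurableSpace α] {μ : Measure α}
    [IsProbabilityMeasure μ] {X : α → ℝ} (hX : Measurable X) (hX0 : ∀ z, 0 ≤ X z)
    (hi : Integrable X μ) (hi2 : Integrable (fun z => X z ^ 2) μ) {M : ℝ} (hM : 0 < M)
    (h2 : ∫ z, X z ^ 2 ∂μ ≤ M) (m : ℕ) :
    (Measure.pi fun _ : Fin m => μ).real {z | ∑ i, X (z i) ≤ m * (∫ z, X z ∂μ) / 2} ≤
      Real.exp (-((∫ z, X z ∂μ) ^ 2 / (8 * M)) * m) := by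
  set l := ∫ z, X z ∂μ with hl
  have hl0 : 0 ≤ l := integral_nonneg hX0
  -- Minimizer of the Chernoff exponent `-s l / 2 + s² M / 2` per sample.
  set s := l / (2 * M) with hs
  have hs0 : 0 ≤ s := by positivity
  have hquad : ∀ x : ℝ, 0 ≤ x → Real.exp (-x) ≤ 1 - x + x ^ 2 / 2 := by
    intro x hx
    rw [Real.exp_neg, inv_le_iff_one_le_mul₀ (Real.exp_pos _)]
    have h1 := Real.quadratic_le_exp_of_nonneg hx
    have h3 : 0 ≤ 1 - x + x ^ 2 / 2 := by nlinarith [sq_nonneg (x - 1)]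
    nlinarith [mul_le_mul_of_nonneg_left h1 h3, sq_nonneg (x ^ 2)]
  have hiexp : Integrable (fun z => Real.exp (-(s * X z))) μ := by
    refine (integrable_const (1 : ℝ)).mono' (by fun_prop) (Eventually.of_forall fun z => ?_)
    rw [Real.norm_of_nonneg (Real.exp_pos _).le, Real.exp_le_one_iff]
    nlinarith [mul_nonneg hs0 (hX0 z)]
  have hb : ∫ z, Real.exp (-(s * X z)) ∂μ ≤ Real.exp (-(s * l) + s ^ 2 * M / 2) := by
    calc ∫ z, Real.exp (-(s * X z)) ∂μ ≤ ∫ z, (1 - s * X z + s ^ 2 / 2 * X z ^ 2) ∂μ := by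
          refine integral_mono hiexp
            (((integrable_const _).sub (hi.const_mul _)).add (hi2.const_mul _)) fun z => ?_
          have := hquad _ (mul_nonneg hs0 (hX0 z))
          rw [mul_pow] at this
          linarith
      _ = 1 - s * l + s ^ 2 / 2 * ∫ z, X z ^ 2 ∂μ := by
          rw [integral_add (f := fun z => 1 - s * X z)
            ((integrable_const _).sub (hi.const_mul _)) (hi2.const_mul _),
            integral_sub (integrable_const _) (hi.const_mul _), integral_const_mul,
            integral_const_mul]
          simp [hl]
      _ ≤ 1 - s * l + s ^ 2 / 2 * M := by gcongr
      _ ≤ _ := by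
          have := Real.add_one_le_exp (-(s * l) + s ^ 2 * M / 2)
          linarith
  have := measureReal_pi_sum_ge_le (X := fun z => -(s * X z)) hiexp hb m
    (-(s * (m * l / 2)))
  refine (measureReal_mono fun z hz => ?_).trans (this.trans (Real.exp_le_exp.2 (le_of_eq ?_)))
  · simp only [Set.mem_ofPred_eq] at hz ⊢
    rw [Finset.sum_neg_distrib, ← Finset.mul_sum]
    exact neg_le_neg (mul_le_mul_of_nonneg_left hz hs0)
  · rw [hs]; field_simp; ring

/-- Upper tail of a sum of independent bounded nonnegative variables. -/
lemma measureReal_pi_sum_ge_nine_mean {α : Type*} [MeasurableSpace α] {μ : Measure α}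
    [IsProbabilityMeasure μ] {X : α → ℝ} (hX : Measurable X) (hX0 : ∀ z, 0 ≤ X z)
    {M : ℝ} (hM : 0 < M) (hXM : ∀ z, X z ≤ M) (m : ℕ) :
    (Measure.pi fun _ : Fin m => μ).real {z | 9 * (m * ∫ z, X z ∂μ) ≤ ∑ i, X (z i)} ≤
      Real.exp (-(7 * (∫ z, X z ∂μ) / M) * m) := by
  have hi : Integrable X μ := (integrable_const M).mono' hX.aestronglyMeasurable
    (Eventually.of_forall fun z => by rw [Real.norm_of_nonneg (hX0 z)]; exact hXM z)
  have hiexp : Integrable (fun z => Real.exp (X z / M)) μ := by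
    refine (integrable_const (Real.exp 1)).mono' (by fun_prop) (Eventually.of_forall fun z => ?_)
    rw [Real.norm_of_nonneg (Real.exp_pos _).le, Real.exp_le_exp, div_le_one hM]
    exact hXM z
  have hb : ∫ z, Real.exp (X z / M) ∂μ ≤ Real.exp (2 * (∫ z, X z ∂μ) / M) := by
    calc ∫ z, Real.exp (X z / M) ∂μ ≤ ∫ z, (1 + 2 / M * X z) ∂μ := by
          refine integral_mono hiexp ((integrable_const _).add (hi.const_mul _)) fun z => ?_
          have h0 : 0 ≤ X z / M := div_nonneg (hX0 z) hM.le
          have h1 : X z / M ≤ 1 := (div_le_one hM).2 (hXM z)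
          -- `exp t ≤ 1 + 2 t` on `[0, 1]`; this costs twice the mean, leaving `9 - 2 = 7` in the
          -- exponent.
          have h2 := Real.abs_exp_sub_one_le (x := X z / M) (by rwa [abs_of_nonneg h0])
          rw [abs_of_nonneg h0] at h2
          have h3 := (abs_le.1 h2).2
          have h4 : 2 / M * X z = 2 * (X z / M) := by ring
          simp only [h4]
          linarith
      _ = 2 * (∫ z, X z ∂μ) / M + 1 := by
          rw [integral_add (integrable_const _) (hi.const_mul _), integral_const_mul]
          simp; ring
      _ ≤ _ := Real.add_one_le_exp _
  have := measureReal_pi_sum_ge_le (X := fun z => X z / M) hiexp hb m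
    (9 * (m * ∫ z, X z ∂μ) / M)
  refine (measureReal_mono fun z hz => ?_).trans (this.trans (Real.exp_le_exp.2 (le_of_eq ?_)))
  · simp only [Set.mem_ofPred_eq] at hz ⊢
    rw [← Finset.sum_div]
    gcongr
  · ring

end GaussianLaws

/-! ### Elementary bounds for the quantizer. -/

namespace Quantizer

variable {b : ℕ} (q : Quantizer b)

lemma exists_mem_bin {r : ℝ} (hr : 0 ≤ r) : ∃ k, r ∈ q.bin k := by
  have hne : (Finset.univ.filter fun k : Fin (2 ^ (b - 1)) =>
      q.t k.castSucc ≤ (r : EReal)).Nonempty := by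
    refine ⟨0, ?_⟩
    simp [q.t_zero, hr]
  -- Take the last threshold not exceeding `r`; the final threshold `⊤` is never reached.
  obtain ⟨k, hk, hmax⟩ := Finset.exists_max_image _ id hne
  simp only [Finset.mem_filter, Finset.mem_univ, true_and, id] at hk hmax
  refine ⟨k, hk, ?_⟩
  by_contra hlt
  rw [not_lt] at hlt
  by_cases hlast : k.succ = Fin.last _
  · rw [hlast, q.t_last] at hlt
    exact absurd (top_le_iff.1 hlt) (EReal.coe_ne_top r)
  · have := hmax (k.succ.castPred hlast) (by simpa using hlt)
    have h2 : k.succ ≤ k.castSucc := by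
      rw [Fin.le_def] at this ⊢
      simp at this
    exact absurd h2 (not_le.2 Fin.castSucc_lt_succ)

lemma bin_unique {r : ℝ} {k l : Fin (2 ^ (b - 1))} (hk : r ∈ q.bin k) (hl : r ∈ q.bin l) :
    k = l := by
  have h : ∀ {k l : Fin (2 ^ (b - 1))}, r ∈ q.bin k → r ∈ q.bin l → l ≤ k := by
    intro k l hk hl
    have := q.t_strictMono.lt_iff_lt.1 (hl.1.trans_lt hk.2)
    rw [Fin.lt_def] at this
    rw [Fin.le_def]
    simp at this
    omega
  exact le_antisymm (h hl hk) (h hk hl)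

lemma sum_indicator_of_mem {r : ℝ} {k : Fin (2 ^ (b - 1))} (hk : r ∈ q.bin k) :
    ∑ l, (q.bin l).indicator (fun _ => q.rep l) r = q.rep k := by
  rw [Finset.sum_eq_single k]
  · simp [hk]
  · intro l _ hl
    exact Set.indicator_of_notMem (fun h => hl (q.bin_unique h hk)) _
  · simp

lemma exists_map_eq (z : ℝ) : ∃ k, q.map z = Real.sign z * q.rep k := by
  obtain ⟨k, hk⟩ := q.exists_mem_bin (abs_nonneg z)
  exact ⟨k, by rw [map, q.sum_indicator_of_mem hk]⟩

lemma measurable_map : Measurable q.map := by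
  have hbin : ∀ k, MeasurableSet (q.bin k) := fun k =>
    (measurableSet_le measurable_const measurable_coe_real_ereal).inter
      (measurableSet_lt measurable_coe_real_ereal measurable_const)
  have hsign : Measurable Real.sign := by
    have : Real.sign = fun r : ℝ => if r < 0 then -1 else if 0 < r then 1 else 0 := rfl
    rw [this]
    exact Measurable.ite measurableSet_Iio measurable_const
      (Measurable.ite measurableSet_Ioi measurable_const measurable_const)
  refine hsign.mul (Finset.measurable_sum _ fun k _ => ?_)
  exact (measurable_const.indicator (hbin k)).comp measurable_abs

/-- The bounds are the smallest and largest representatives. The point `0` is excluded from the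
lower bound because `Real.sign 0 = 0`. -/
lemma exists_bounds : ∃ μ₀ M : ℝ, 0 < μ₀ ∧ 0 < M ∧ (∀ z, μ₀ * |z| ≤ q.map z * z) ∧
    (∀ z, z ≠ 0 → μ₀ ≤ |q.map z|) ∧ ∀ z, |q.map z| ≤ M := by
  have hsign : ∀ z : ℝ, Real.sign z * z = |z| := fun z => by
    rcases lt_trichotomy z 0 with h | h | h
    · simp [Real.sign_of_neg h, abs_of_neg h]
    · simp [h]
    · simp [Real.sign_of_pos h, abs_of_pos h]
  have h0 : ∀ k, q.rep 0 ≤ q.rep k := fun k => q.rep_strictMono.monotone (Fin.zero_le k)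
  have h1 : ∀ k, q.rep k ≤ q.rep ⊤ := fun k => q.rep_strictMono.monotone le_top
  refine ⟨q.rep 0, q.rep ⊤, q.rep_pos _, q.rep_pos _, fun z => ?_, fun z hz => ?_, fun z => ?_⟩
  · obtain ⟨k, hk⟩ := q.exists_map_eq z
    rw [hk, mul_right_comm, hsign, mul_comm]
    exact mul_le_mul_of_nonneg_left (h0 k) (abs_nonneg z)
  · obtain ⟨k, hk⟩ := q.exists_map_eq z
    rw [hk, abs_mul, abs_of_pos (q.rep_pos k)]
    have : |Real.sign z| = 1 := by
      rcases Real.sign_apply_eq_of_ne_zero z hz with h | h <;> simp [h]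
    rw [this, one_mul]
    exact h0 k
  · obtain ⟨k, hk⟩ := q.exists_map_eq z
    rw [hk, abs_mul, abs_of_pos (q.rep_pos k)]
    have : |Real.sign z| ≤ 1 := by
      rcases Real.sign_apply_eq z with h | h | h <;> simp [h]
    exact (mul_le_of_le_one_left (q.rep_pos k).le this).trans (h1 k)

end Quantizer

/-! ### The constants `λ` and `Ψ` in reflected coordinates. -/

section Constants

lemma measurePreserving_planeReflection_real {ρ τ : ℝ} (h : ρ ^ 2 + τ ^ 2 = 1) :
    MeasurePreserving (fun p : ℝ × ℝ => (ρ * p.2 - τ * p.1, τ * p.2 + ρ * p.1))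
      ((gaussianReal 0 1).prod (gaussianReal 0 1)) ((gaussianReal 0 1).prod (gaussianReal 0 1)) := by
  have := measurePreserving_planeReflection (V := ℝ) (u := 1) (by simp) h
  rw [stdGaussian_real] at this
  convert this using 2 with p
  ext
  · simp [planeReflection]; ring
  · simp [planeReflection]

variable {b : ℕ} (q : Quantizer b)

/-- After reflection the quantizer sees only `r z`, while `g = ρ z - τ k` with `k` centred and
independent of `z`, so the `k` term integrates to zero. -/
lemma lam_eq {σ ψ ρ τ r : ℝ} (h : ρ ^ 2 + τ ^ 2 = 1) (hψ : ψ = r * ρ) (hσ : σ = r * τ) :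
    lam q σ ψ = ρ * ∫ z, q.map (r * z) * z ∂(gaussianReal 0 1) := by
  obtain ⟨-, M, -, hM, -, -, hqM⟩ := q.exists_bounds
  have hqm := q.measurable_map
  have hid : Integrable (fun z : ℝ => z) (gaussianReal 0 1) := IsGaussian.integrable_id
  have hbdd : ∀ {f : ℝ × ℝ → ℝ} (_ : Measurable f) (g : ℝ × ℝ → ℝ)
      (_ : Integrable g ((gaussianReal 0 1).prod (gaussianReal 0 1))),
      Integrable (fun p => q.map (f p) * g p) ((gaussianReal 0 1).prod (gaussianReal 0 1)) := by
    intro f hf g hg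
    exact hg.bdd_mul (c := M) (hqm.comp hf).aestronglyMeasurable
      (Eventually.of_forall fun p => hqM _)
  have hfst : Integrable (fun p : ℝ × ℝ => p.1) ((gaussianReal 0 1).prod (gaussianReal 0 1)) :=
    hid.comp_fst _
  have hsnd : Integrable (fun p : ℝ × ℝ => p.2) ((gaussianReal 0 1).prod (gaussianReal 0 1)) :=
    hid.comp_snd _
  have hz : ∫ z : ℝ, z ∂(gaussianReal 0 1) = 0 := integral_id_gaussianReal
  calc lam q σ ψ = ∫ p : ℝ × ℝ, q.map (ψ * p.1 + σ * p.2) * p.1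
        ∂((gaussianReal 0 1).prod (gaussianReal 0 1)) := by
        rw [integral_prod _ (hbdd (by fun_prop) _ hfst)]
        simp only [lam, theta, integral_mul_const]
    _ = ∫ p : ℝ × ℝ, q.map (r * p.2) * (ρ * p.2 - τ * p.1)
        ∂((gaussianReal 0 1).prod (gaussianReal 0 1)) := by
        have hmp := measurePreserving_planeReflection_real h
        have hm : Measurable fun p : ℝ × ℝ => q.map (ψ * p.1 + σ * p.2) * p.1 := by fun_prop
        rw [← hmp.map_eq, integral_map hmp.measurable.aemeasurable
          hm.aestronglyMeasurable, hmp.map_eq]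
        congr 1
        ext p
        congr 2
        rw [hψ, hσ]
        linear_combination r * p.2 * h
    _ = ∫ z, ∫ k, q.map (r * z) * (ρ * z - τ * k) ∂(gaussianReal 0 1) ∂(gaussianReal 0 1) := by
        rw [integral_prod_symm]
        exact hbdd (by fun_prop) _ ((hsnd.const_mul ρ).sub (hfst.const_mul τ))
    _ = ∫ z, ρ * (q.map (r * z) * z) ∂(gaussianReal 0 1) := by
        congr 1
        ext z
        rw [integral_const_mul, integral_sub (integrable_const _) (hid.const_mul τ),
          integral_const_mul τ, hz]
        simp
        ring
    _ = _ := integral_const_mul _ _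

lemma Psi_sq_eq {σ ψ ρ τ r : ℝ} (h : ρ ^ 2 + τ ^ 2 = 1) (hψ : ψ = r * ρ) (hσ : σ = r * τ) :
    Psi q σ ψ ^ 2 = ∫ z, q.map (r * z) ^ 2 ∂(gaussianReal 0 1) := by
  have hqm := q.measurable_map
  rw [Psi, Real.sq_sqrt (integral_nonneg fun p => sq_nonneg _)]
  have hmp := measurePreserving_planeReflection_real h
  have hm : Measurable fun p : ℝ × ℝ => q.map (ψ * p.1 + σ * p.2) ^ 2 := by fun_prop
  rw [← hmp.map_eq, integral_map hmp.measurable.aemeasurable hm.aestronglyMeasurable]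
  have : ∀ p : ℝ × ℝ, ψ * (ρ * p.2 - τ * p.1) + σ * (τ * p.2 + ρ * p.1) = r * p.2 := by
    intro p
    rw [hψ, hσ]
    linear_combination r * p.2 * h
  simp only [this]
  rw [integral_fun_snd (fun z => q.map (r * z) ^ 2)]
  simp

lemma integral_abs_gaussianReal_pos : 0 < ∫ z : ℝ, |z| ∂(gaussianReal 0 1) := by
  have hid : Integrable (fun z : ℝ => |z|) (gaussianReal 0 1) :=
    (IsGaussian.integrable_id (μ := gaussianReal 0 1)).abs
  rw [integral_pos_iff_support_of_nonneg (fun _ => abs_nonneg _) hid]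
  have : Function.support (fun z : ℝ => |z|) = {0}ᶜ := by ext; simp
  rw [this, prob_compl_eq_one_sub (measurableSet_singleton 0)]
  have h0 : NullSingletonClass (gaussianReal 0 1) := nullSingletonClass_gaussianReal (by simp)
  simp

end Constants

/-! ### The three events that control the sample. -/

section Tails

variable {V : Type*} [NormedAddCommGroup V] [InnerProductSpace ℝ V] [FiniteDimensional ℝ V]
  [MeasurableSpace V] [BorelSpace V]

/-- The weights are fixed, so the sum is distributed as `√(∑ yᵢ²)` times one Gaussian vector.
Concentration at `t = w` adds `L w` to a mean of at most `L w`. -/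
lemma measureReal_pi_seminorm_sum_gt_le {L : NNReal} {p : Seminorm ℝ V} (hp : LipschitzWith L p)
    (hL : 0 < L) {w : ℝ} (hw : 0 ≤ w) (hpw : ∫ k, p k ∂(stdGaussian V) ≤ L * w) {m : ℕ}
    (y : Fin m → ℝ) :
    (Measure.pi fun _ : Fin m => stdGaussian V).real
        {k | √(∑ i, y i ^ 2) * (2 * L * w) < p (∑ i, y i • k i)} ≤ Real.exp (-(w ^ 2 / 5)) := by
  set s := √(∑ i, y i ^ 2) with hs
  have hs0 : 0 ≤ s := Real.sqrt_nonneg _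
  have hpm : Measurable p := hp.continuous.measurable
  have hset : MeasurableSet {k : V | s * (2 * L * w) < p k} :=
    measurableSet_lt measurable_const hpm
  have e1 : {k : Fin m → V | s * (2 * L * w) < p (∑ i, y i • k i)} =
      (fun k : Fin m → V => ∑ i, y i • k i) ⁻¹' {k : V | s * (2 * L * w) < p k} := rfl
  rw [e1, ← map_measureReal_apply (by fun_prop) hset, map_sum_smul_stdGaussian,
    map_measureReal_apply (by fun_prop) hset]
  refine le_trans (measureReal_mono fun k hk => ?_) (measureReal_ge_le_of_lipschitz hp hL hw)
  simp only [Set.mem_preimage, Set.mem_ofPred_eq, map_smul_eq_mul, ← hs,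
    Real.norm_of_nonneg hs0] at hk ⊢
  have := lt_of_mul_lt_mul_left hk hs0
  linarith

/-- The good event for pairs `(kᵢ, zᵢ)` of independent standard Gaussians. -/
def goodEvent (Q : ℝ → ℝ) (p : V → ℝ) (L w : ℝ) (m : ℕ) : Set (Fin m → V × ℝ) :=
  {x | m * (∫ z, Q z * z ∂(gaussianReal 0 1)) / 2 < ∑ i, Q (x i).2 * (x i).2 ∧
    ∑ i, Q (x i).2 ^ 2 < 9 * (m * ∫ z, Q z ^ 2 ∂(gaussianReal 0 1)) ∧
    p (∑ i, Q (x i).2 • (x i).1) ≤ √(∑ i, Q (x i).2 ^ 2) * (2 * L * w)}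

lemma measurableSet_goodEvent {Q : ℝ → ℝ} (hQ : Measurable Q) {p : V → ℝ} (hp : Measurable p)
    (L w : ℝ) (m : ℕ) : MeasurableSet (goodEvent Q p L w m) := by
  simp only [goodEvent, Set.ofPred_and]
  exact (measurableSet_lt (by fun_prop) (by fun_prop)).inter
    ((measurableSet_lt (by fun_prop) (by fun_prop)).inter
      (measurableSet_le (by fun_prop) (by fun_prop)))

lemma measureReal_compl_goodEvent_le {Q : ℝ → ℝ} (hQ : Measurable Q) {M : ℝ} (hM : 0 < M)
    (hQM : ∀ z, |Q z| ≤ M) (hQ0 : ∀ z, 0 ≤ Q z * z) {L : NNReal} {p : Seminorm ℝ V}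
    (hp : LipschitzWith L p) (hL : 0 < L) {w : ℝ} (hw : 0 ≤ w)
    (hpw : ∫ k, p k ∂(stdGaussian V) ≤ L * w) (m : ℕ) :
    (Measure.pi fun _ : Fin m => (stdGaussian V).prod (gaussianReal 0 1)).real
        (goodEvent Q p L w m)ᶜ ≤
      Real.exp (-((∫ z, Q z * z ∂(gaussianReal 0 1)) ^ 2 / (8 * M ^ 2)) * m) +
      Real.exp (-(7 * (∫ z, Q z ^ 2 ∂(gaussianReal 0 1)) / M ^ 2) * m) +
      Real.exp (-(w ^ 2 / 5)) := by
  have hpm : Measurable p := hp.continuous.measurable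
  set μ := Measure.pi fun _ : Fin m => (stdGaussian V).prod (gaussianReal 0 1) with hμ
  have hsnd : MeasurePreserving (fun (x : Fin m → V × ℝ) i => (x i).2) μ
      (Measure.pi fun _ : Fin m => gaussianReal 0 1) :=
    measurePreserving_pi _ _ fun _ => measurePreserving_snd
  set B₁ : Set (Fin m → ℝ) :=
    {z | ∑ i, Q (z i) * z i ≤ m * (∫ z, Q z * z ∂(gaussianReal 0 1)) / 2} with hB₁
  set B₂ : Set (Fin m → ℝ) :=
    {z | 9 * (m * ∫ z, Q z ^ 2 ∂(gaussianReal 0 1)) ≤ ∑ i, Q (z i) ^ 2} with hB₂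
  set B₃ : Set ((Fin m → V) × (Fin m → ℝ)) :=
    {x | √(∑ i, Q (x.2 i) ^ 2) * (2 * L * w) < p (∑ i, Q (x.2 i) • x.1 i)} with hB₃
  have hm₁ : MeasurableSet B₁ := measurableSet_le (by fun_prop) (by fun_prop)
  have hm₂ : MeasurableSet B₂ := measurableSet_le (by fun_prop) (by fun_prop)
  have hm₃ : MeasurableSet B₃ := measurableSet_lt (by fun_prop) (by fun_prop)
  have hsplit := measurePreserving_arrowProdEquivProdArrow V ℝ (Fin m)
    (fun _ => stdGaussian V) (fun _ => gaussianReal 0 1)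
  have hsub : (goodEvent Q p L w m)ᶜ ⊆ ((fun (x : Fin m → V × ℝ) i => (x i).2) ⁻¹' B₁ ∪
      (fun (x : Fin m → V × ℝ) i => (x i).2) ⁻¹' B₂) ∪
      (MeasurableEquiv.arrowProdEquivProdArrow V ℝ (Fin m)) ⁻¹' B₃ := by
    intro x hx
    by_contra hcon
    simp only [Set.mem_union, not_or] at hcon
    obtain ⟨⟨h1, h2⟩, h3⟩ := hcon
    exact hx ⟨not_le.1 h1, not_le.1 h2, not_lt.1 h3⟩
  have hsq : ∀ z, Q z ^ 2 ≤ M ^ 2 := fun z => by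
    rw [← sq_abs]
    exact pow_le_pow_left₀ (abs_nonneg _) (hQM z) 2
  have hid : Integrable (fun z : ℝ => z) (gaussianReal 0 1) := IsGaussian.integrable_id
  have hid2 : Integrable (fun z : ℝ => z ^ 2) (gaussianReal 0 1) :=
    (IsGaussian.memLp_two_id (μ := gaussianReal 0 1)).integrable_sq
  have hvar : ∫ z : ℝ, z ^ 2 ∂(gaussianReal 0 1) = 1 := by
    have h1 := variance_id_gaussianReal (μ := 0) (v := 1)
    rw [variance_of_integral_eq_zero aemeasurable_id (by simp)] at h1
    simpa using h1
  have b₁ : μ.real ((fun (x : Fin m → V × ℝ) i => (x i).2) ⁻¹' B₁) ≤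
      Real.exp (-((∫ z, Q z * z ∂(gaussianReal 0 1)) ^ 2 / (8 * M ^ 2)) * m) := by
    rw [hsnd.measureReal_preimage hm₁.nullMeasurableSet]
    have hle : ∀ z, (Q z * z) ^ 2 ≤ M ^ 2 * z ^ 2 := fun z => by
      rw [mul_pow]
      exact mul_le_mul_of_nonneg_right (hsq z) (sq_nonneg z)
    have hi2 : Integrable (fun z => (Q z * z) ^ 2) (gaussianReal 0 1) := by
      refine (hid2.const_mul (M ^ 2)).mono' (by fun_prop) (Eventually.of_forall fun z => ?_)
      rw [Real.norm_of_nonneg (sq_nonneg _)]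
      exact hle z
    refine measureReal_pi_sum_le_half_mean (X := fun z => Q z * z) (by fun_prop) hQ0 ?_ hi2
      (by positivity) ?_ m
    · exact hid.bdd_mul (c := M) hQ.aestronglyMeasurable (Eventually.of_forall hQM)
    · refine (integral_mono hi2 (hid2.const_mul (M ^ 2)) hle).trans ?_
      rw [integral_const_mul, hvar, mul_one]
  have b₂ : μ.real ((fun (x : Fin m → V × ℝ) i => (x i).2) ⁻¹' B₂) ≤
      Real.exp (-(7 * (∫ z, Q z ^ 2 ∂(gaussianReal 0 1)) / M ^ 2) * m) := by
    rw [hsnd.measureReal_preimage hm₂.nullMeasurableSet]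
    exact measureReal_pi_sum_ge_nine_mean (X := fun z => Q z ^ 2) (by fun_prop)
      (fun z => sq_nonneg _) (by positivity) hsq m
  have b₃ : μ.real ((MeasurableEquiv.arrowProdEquivProdArrow V ℝ (Fin m)) ⁻¹' B₃) ≤
      Real.exp (-(w ^ 2 / 5)) := by
    -- Fubini: freezing the `zᵢ` makes the weights `Q zᵢ` deterministic, and the bound is uniform in
    -- them.
    rw [hsplit.measureReal_preimage hm₃.nullMeasurableSet, Measure.real,
      Measure.prod_apply_symm hm₃]
    refine ENNReal.toReal_le_of_le_ofReal (Real.exp_pos _).le ?_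
    calc _ ≤ ∫⁻ _z : Fin m → ℝ, ENNReal.ofReal (Real.exp (-(w ^ 2 / 5)))
            ∂(Measure.pi fun _ : Fin m => gaussianReal 0 1) := by
          refine lintegral_mono fun z => ?_
          have := measureReal_pi_seminorm_sum_gt_le hp hL hw hpw (fun i => Q (z i))
          rw [Measure.real, ← ENNReal.le_ofReal_iff_toReal_le (measure_ne_top _ _)
            (Real.exp_pos _).le] at this
          exact this
      _ = _ := by simp
  calc _ ≤ _ := measureReal_mono hsub
    _ ≤ _ := (measureReal_union_le _ _).trans
      (add_le_add_left (measureReal_union_le _ _) _)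
    _ ≤ _ := by gcongr

end Tails

/-! ### The Gaussian width as the mean of a seminorm. -/

section Width

variable {n : ℕ}

lemma bddAbove_abs_inner {T : Set (E n)} (hT : T ⊆ Metric.sphere 0 1) (g : E n) :
    BddAbove (Set.range fun v : T => |⟪g, (v : E n)⟫|) := by
  refine ⟨‖g‖, ?_⟩
  rintro _ ⟨v, rfl⟩
  have hv : ‖(v : E n)‖ = 1 := by simpa using hT v.2
  simpa [hv] using abs_real_inner_le_norm g v

/-- The seminorm `g ↦ sup_{v ∈ T} |⟨g, v⟩|` of a set `T` of unit vectors. -/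
noncomputable def widthSeminorm (T : Set (E n)) (hT : T ⊆ Metric.sphere 0 1) : Seminorm ℝ (E n) :=
  Seminorm.ofSMulLE (fun g => ⨆ v : T, |⟪g, (v : E n)⟫|) (by simp)
    (fun g h => by
      -- `Real.iSup_le` also asks for a nonnegative bound, which covers `T = ∅`, where the supremum
      -- is `0`.
      refine Real.iSup_le (fun v => ?_) (add_nonneg (Real.iSup_nonneg fun _ => abs_nonneg _)
        (Real.iSup_nonneg fun _ => abs_nonneg _))
      rw [inner_add_left]
      exact (abs_add_le _ _).trans (add_le_add (le_ciSup (bddAbove_abs_inner hT g) v)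
        (le_ciSup (bddAbove_abs_inner hT h) v)))
    (fun r g => by
      refine Real.iSup_le (fun v => ?_) (mul_nonneg (norm_nonneg _)
        (Real.iSup_nonneg fun _ => abs_nonneg _))
      rw [inner_smul_left, abs_mul]
      exact mul_le_mul_of_nonneg_left (le_ciSup (bddAbove_abs_inner hT g) v) (abs_nonneg _))

variable {T : Set (E n)} (hT : T ⊆ Metric.sphere 0 1)

lemma abs_inner_le_widthSeminorm {v : E n} (hv : v ∈ T) (g : E n) :
    |⟪g, v⟫| ≤ widthSeminorm T hT g :=
  le_ciSup (bddAbove_abs_inner hT g) (⟨v, hv⟩ : T)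

lemma widthSeminorm_le_norm (g : E n) : widthSeminorm T hT g ≤ ‖g‖ := by
  refine Real.iSup_le (fun v => ?_) (norm_nonneg g)
  have hv : ‖(v : E n)‖ = 1 := by simpa using hT v.2
  simpa [hv] using abs_real_inner_le_norm g v

lemma gaussianWidth_eq : gaussianWidth T = ∫ g, widthSeminorm T hT g ∂(stdGaussian (E n)) := rfl

lemma lipschitzWith_widthSeminorm_comp (A : E n →L[ℝ] E n) :
    LipschitzWith ‖A‖₊ ((widthSeminorm T hT).comp (A : E n →ₗ[ℝ] E n)) := by
  refine LipschitzWith.of_dist_le_mul fun g h => ?_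
  rw [Real.dist_eq]
  refine (abs_sub_map_le_sub _ _ _).trans ?_
  rw [Seminorm.comp_apply, dist_eq_norm]
  exact (widthSeminorm_le_norm hT _).trans (A.le_opNorm _)

/-- Dividing `A ∘ B` by `‖A‖` gives a contraction, so the contraction inequality applies. -/
lemma integral_widthSeminorm_comp_le (A B : E n →L[ℝ] E n) (hB : ‖B‖ ≤ 1) :
    ∫ g, widthSeminorm T hT (A (B g)) ∂(stdGaussian (E n)) ≤ ‖A‖ * gaussianWidth T := by
  by_cases hA : A = 0
  · simp [hA]
  have hA' : 0 < ‖A‖ := norm_pos_iff.2 hA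
  have hC : ‖‖A‖⁻¹ • (A.comp B)‖ ≤ 1 := by
    rw [norm_smul, norm_inv, norm_norm, inv_mul_le_one₀ hA']
    exact (A.opNorm_comp_le B).trans (mul_le_of_le_one_right hA'.le hB)
  have hlip : LipschitzWith ‖ContinuousLinearMap.id ℝ (E n)‖₊ (widthSeminorm T hT) :=
    lipschitzWith_widthSeminorm_comp hT (ContinuousLinearMap.id ℝ (E n))
  have := integral_seminorm_comp_le_of_contraction (widthSeminorm T hT) hlip _ hC
  simp only [smul_apply, ContinuousLinearMap.comp_apply, map_smul_eq_mul, norm_inv, norm_norm]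
    at this
  rw [integral_const_mul, inv_mul_le_iff₀ hA'] at this
  rw [gaussianWidth_eq hT]
  exact this

lemma gaussianWidth_nonneg (hT : T ⊆ Metric.sphere 0 1) : 0 ≤ gaussianWidth T := by
  rw [gaussianWidth_eq hT]
  exact integral_nonneg fun g => apply_nonneg _ _

end Width

/-! ### The square root of the covariance and its condition number. -/

section SquareRoot

variable {n : ℕ} {S : Matrix (Fin n) (Fin n) ℝ}

lemma isUnit_det_sqrt (hS : S.PosDef) : IsUnit (CFC.sqrt S).det := by
  have h := congrArg Matrix.det (CFC.sqrt_mul_sqrt_self S hS.posSemidef.nonneg)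
  rw [Matrix.det_mul] at h
  exact isUnit_iff_ne_zero.2 fun h0 => hS.det_pos.ne' (by rw [← h, h0, zero_mul])

lemma sqrt_inv_apply_sqrt (hS : S.PosDef) (v : E n) :
    Matrix.toEuclideanCLM (𝕜 := ℝ) (CFC.sqrt S)⁻¹ (Matrix.toEuclideanCLM (𝕜 := ℝ) (CFC.sqrt S) v)
      = v := by
  rw [← mul_apply_eq_comp, ← map_mul, Matrix.nonsing_inv_mul _ (isUnit_det_sqrt hS), map_one]
  rfl

lemma sqrt_apply_sqrt_inv (hS : S.PosDef) (v : E n) :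
    Matrix.toEuclideanCLM (𝕜 := ℝ) (CFC.sqrt S) (Matrix.toEuclideanCLM (𝕜 := ℝ) (CFC.sqrt S)⁻¹ v)
      = v := by
  rw [← mul_apply_eq_comp, ← map_mul, Matrix.mul_nonsing_inv _ (isUnit_det_sqrt hS), map_one]
  rfl

lemma inv_apply_eq (hS : S.PosDef) (v : E n) :
    Matrix.toEuclideanCLM (𝕜 := ℝ) S⁻¹ v = Matrix.toEuclideanCLM (𝕜 := ℝ) (CFC.sqrt S)⁻¹
      (Matrix.toEuclideanCLM (𝕜 := ℝ) (CFC.sqrt S)⁻¹ v) := by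
  rw [← mul_apply_eq_comp, ← map_mul, ← Matrix.mul_inv_rev,
    CFC.sqrt_mul_sqrt_self S hS.posSemidef.nonneg]

lemma inner_sqrt_apply (v v' : E n) :
    ⟪Matrix.toEuclideanCLM (𝕜 := ℝ) (CFC.sqrt S) v, v'⟫ =
      ⟪v, Matrix.toEuclideanCLM (𝕜 := ℝ) (CFC.sqrt S) v'⟫ := by
  have h : IsSelfAdjoint (Matrix.toEuclideanCLM (𝕜 := ℝ) (CFC.sqrt S)) :=
    (CFC.sqrt_nonneg S).isSelfAdjoint.map _
  rw [← ContinuousLinearMap.adjoint_inner_left, h.adjoint_eq]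

/-- Follows from `‖x‖ = ‖J R x‖ ≤ ‖J‖ ‖R‖ ‖x‖`. The nonzero vector rules out dimension `0`, where
the condition number vanishes. -/
lemma one_le_condNumber_sqrt (hS : S.PosDef) {x : E n} (hx : x ≠ 0) :
    1 ≤ condNumber (CFC.sqrt S) := by
  have h1 := ContinuousLinearMap.le_opNorm (Matrix.toEuclideanCLM (𝕜 := ℝ) (CFC.sqrt S)⁻¹)
    (Matrix.toEuclideanCLM (𝕜 := ℝ) (CFC.sqrt S) x)
  rw [sqrt_inv_apply_sqrt hS] at h1
  have h2 := h1.trans (mul_le_mul_of_nonneg_left (ContinuousLinearMap.le_opNorm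
    (Matrix.toEuclideanCLM (𝕜 := ℝ) (CFC.sqrt S)) x) (norm_nonneg _))
  have hx' : 0 < ‖x‖ := norm_pos_iff.2 hx
  unfold condNumber
  by_contra hlt
  nlinarith

lemma scale_pos (hS : S.PosDef) {x : E n} (hx : x ≠ 0) : 0 < scale S x := by
  refine norm_pos_iff.2 fun h => hx ?_
  rw [← sqrt_inv_apply_sqrt hS x, h, map_zero]

end SquareRoot

/-! ### Recovering the whitened vector from its reflected coordinates. -/

section Reflection

variable {V : Type*} [NormedAddCommGroup V] [InnerProductSpace ℝ V]

/-- The map `k ↦ k - (1 + τ) ⟨u, k⟩ u`. -/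
noncomputable def partialReflection (u : V) (τ : ℝ) : V →L[ℝ] V :=
  ContinuousLinearMap.id ℝ V - ((1 + τ) • innerSL ℝ u).smulRight u

lemma partialReflection_apply (u : V) (τ : ℝ) (k : V) :
    partialReflection u τ k = k - ((1 + τ) * ⟪u, k⟫) • u := by
  simp [partialReflection]

/-- The map fixes `u^⊥` and multiplies `u` by `-τ`. -/
lemma norm_partialReflection_le {u : V} (hu : ‖u‖ = 1) {τ : ℝ} (hτ : τ ^ 2 ≤ 1) :
    ‖partialReflection u τ‖ ≤ 1 := by
  refine ContinuousLinearMap.opNorm_le_bound _ zero_le_one fun k => ?_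
  rw [one_mul, partialReflection_apply]
  refine le_of_sq_le_sq ?_ (norm_nonneg _)
  rw [norm_sub_sq_real, inner_smul_right, norm_smul, hu, mul_one, Real.norm_eq_abs, sq_abs,
    real_inner_comm]
  nlinarith [mul_nonneg (sub_nonneg.2 hτ) (sq_nonneg ⟪k, u⟫)]

/-- The plane reflection is its own inverse; this is the first component of that identity. -/
lemma partialReflection_planeReflection {u : V} (hu : ‖u‖ = 1) {ρ τ : ℝ} (h : ρ ^ 2 + τ ^ 2 = 1)
    (g : V) (e : ℝ) :
    partialReflection u τ (planeReflection u ρ τ (g, e)).1 +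
      (ρ * (planeReflection u ρ τ (g, e)).2) • u = g := by
  have huu : ⟪u, u⟫ = 1 := by rw [real_inner_self_eq_norm_sq, hu, one_pow]
  simp only [planeReflection]
  rw [partialReflection_apply, inner_add_right, inner_sub_right, inner_smul_right,
    inner_smul_right, huu]
  have : ∀ c₁ c₂ c₃ c₄ : ℝ, c₂ - c₁ - c₃ + c₄ = 0 →
      g - c₁ • u + c₂ • u - c₃ • u + c₄ • u = g := by
    intro c₁ c₂ c₃ c₄ hc
    have h2 : g - c₁ • u + c₂ • u - c₃ • u + c₄ • u = g + (c₂ - c₁ - c₃ + c₄) • u := by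
      module
    rw [h2, hc, zero_smul, add_zero]
  apply this
  linear_combination ⟪u, g⟫ * h

end Reflection

/-! ### Deterministic error bound for a minimizer. -/

section Deterministic

variable {n : ℕ}

/-- Curvature of the ball: moving from a boundary point inside the ball loses quadratically in the
direction `e`. Expand `‖y‖² ≤ 1` around `e`. -/
lemma inner_sub_le_of_norm_le_one {V : Type*} [NormedAddCommGroup V] [InnerProductSpace ℝ V]
    {e y : V} (he : ‖e‖ = 1) (hy : ‖y‖ ≤ 1) : ⟪e, y - e⟫ ≤ -(‖y - e‖ ^ 2 / 2) := by
  have h := norm_add_sq_real e (y - e)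
  rw [add_sub_cancel, he] at h
  nlinarith [norm_nonneg y]

lemma norm_direction {x : E n} (hx : x ≠ 0) : ‖direction x‖ = 1 := by
  rw [direction, norm_smul, norm_inv, norm_norm, inv_mul_cancel₀ (norm_ne_zero_iff.2 hx)]

lemma sphericalPart_subset (C : Set (E n)) (x₀ : E n) :
    sphericalPart C x₀ ⊆ Metric.sphere 0 1 := Set.inter_subset_right

/-- If `S⁻¹ η` is a positive multiple of `x` up to an error, then a minimizer is close to the
direction of `x`. -/
lemma mul_norm_sub_direction_le {S : Matrix (Fin n) (Fin n) ℝ} {K : Set (E n)} {x : E n}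
    (hx : x ≠ 0) (hxK : direction x ∈ K) {η xhat h : E n} {α δ : ℝ} (hα : 0 ≤ α) (hδ : 0 ≤ δ)
    (hη : Matrix.toEuclideanCLM (𝕜 := ℝ) S⁻¹ η = h + α • x)
    (hh : ∀ v ∈ sphericalPart (constraint K) (direction x), |⟪h, v⟫| ≤ δ)
    (hest : IsEstimate S (constraint K) η xhat) :
    α * ‖x‖ * ‖xhat - direction x‖ ≤ 2 * δ := by
  have hnd := norm_direction hx
  have hdC : direction x ∈ constraint K := ⟨hxK, by simp [hnd]⟩
  have hmin : -⟪xhat, h + α • x⟫ ≤ -⟪direction x, h + α • x⟫ := by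
    have := hest.2 hdC
    simpa only [Set.mem_ofPred_eq, hη] using this
  have hxh : ‖xhat‖ ≤ 1 := by simpa using hest.1.2
  by_cases hd : xhat - direction x = 0
  · rw [hd, norm_zero, mul_zero]; positivity
  have hd' : 0 < ‖xhat - direction x‖ := norm_pos_iff.2 hd
  set d := xhat - direction x with hdef
  -- The normalized error is a tangent direction, so the noise bound applies to it.
  have hv : ‖d‖⁻¹ • d ∈ sphericalPart (constraint K) (direction x) := by
    refine ⟨⟨‖d‖⁻¹, by positivity, xhat, hest.1, rfl⟩, ?_⟩
    rw [mem_sphere_zero_iff_norm, norm_smul, norm_inv, norm_norm, inv_mul_cancel₀ hd'.ne']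
  have h1 := (abs_le.1 (hh _ hv)).2
  rw [inner_smul_right, inv_mul_le_iff₀ hd'] at h1
  have h2 := inner_sub_le_of_norm_le_one hnd hxh
  have h3 : ⟪x, d⟫ = ‖x‖ * ⟪direction x, d⟫ := by
    rw [direction, real_inner_smul_left, ← mul_assoc, mul_inv_cancel₀ (norm_ne_zero_iff.2 hx),
      one_mul]
  have h4 : 0 ≤ ⟪h, d⟫ + α * ⟪x, d⟫ := by
    have : 0 ≤ ⟪d, h + α • x⟫ := by rw [hdef, inner_sub_left]; linarith
    rwa [real_inner_comm, inner_add_left, real_inner_smul_left] at this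
  rw [h3] at h4
  -- Quadratic loss in the signal against linear gain from the noise; cancelling one `‖d‖` leaves
  -- the claim.
  have h5 : α * ‖x‖ * (‖d‖ ^ 2 / 2) ≤ ‖d‖ * δ := by
    have := mul_le_mul_of_nonneg_left h2 (mul_nonneg hα (norm_nonneg x))
    nlinarith
  have h6 : ‖d‖ * (α * ‖x‖ * ‖d‖) ≤ ‖d‖ * (2 * δ) := by nlinarith
  exact le_of_mul_le_mul_left h6 hd'

end Deterministic

/-! ### The law of the whitened and reflected design. -/

lemma _root_.MeasureTheory.MeasurePreserving.comp_pi {Ω α β ι : Type*} [Fintype ι]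
    [MeasurableSpace Ω] [MeasurableSpace α] [MeasurableSpace β] {P : Measure Ω} {μ : Measure α}
    {ν : Measure β} [SigmaFinite ν] {F : α → β} (hF : MeasurePreserving F μ ν) {X : Ω → ι → α}
    (hX : MeasurePreserving X P (Measure.pi fun _ => μ)) :
    MeasurePreserving (fun ω i => F (X ω i)) P (Measure.pi fun _ => ν) :=
  (measurePreserving_pi (fun _ => μ) (fun _ => ν) fun _ => hF).comp hX

section Design

variable {n m : ℕ} {S : Matrix (Fin n) (Fin n) ℝ} {Ω : Type*} [MeasurableSpace Ω]
  {P : Measure Ω} [IsProbabilityMeasure P] {a : Fin m → Ω → E n} {ε : Fin m → Ω → ℝ}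

lemma IsDesign.measurePreserving_pi (hD : IsDesign S P a ε) :
    MeasurePreserving (fun ω i => (a i ω, ε i ω)) P
      (Measure.pi fun _ : Fin m => (multivariateGaussian 0 S).prod (gaussianReal 0 1)) := by
  have hm : ∀ i, Measurable fun ω => (a i ω, ε i ω) := fun i =>
    (hD.measurable_a i).prodMk (hD.measurable_ε i)
  refine ⟨measurable_pi_lambda _ hm, ?_⟩
  rw [(iIndepFun_iff_map_fun_eq_pi_map fun i => (hm i).aemeasurable).1 hD.iIndep]
  congr 1
  ext1 i
  rw [(indepFun_iff_map_prod_eq_prod_map_map (hD.measurable_a i).aemeasurable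
    (hD.measurable_ε i).aemeasurable).1 (hD.indep_a_ε i), hD.law_a, hD.law_ε]

lemma measurePreserving_sqrt_inv (hS : S.PosDef) :
    MeasurePreserving (Matrix.toEuclideanCLM (𝕜 := ℝ) (CFC.sqrt S)⁻¹)
      (multivariateGaussian 0 S) (stdGaussian (E n)) := by
  obtain ⟨R, hR⟩ : ∃ R, R = Matrix.toEuclideanCLM (𝕜 := ℝ) (CFC.sqrt S) := ⟨_, rfl⟩
  obtain ⟨J, hJ⟩ : ∃ J, J = Matrix.toEuclideanCLM (𝕜 := ℝ) (CFC.sqrt S)⁻¹ := ⟨_, rfl⟩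
  have hJR : ∀ v, J (R v) = v := fun v => by rw [hR, hJ, sqrt_inv_apply_sqrt hS]
  rw [multivariateGaussian, ← hR, ← hJ]
  refine ⟨J.continuous.measurable, ?_⟩
  rw [Measure.map_map J.continuous.measurable (by fun_prop)]
  have : (⇑J ∘ fun x : E n => 0 + R x) = id := by
    ext1 v
    simp only [Function.comp_apply, zero_add, hJR, id]
  rw [this, Measure.map_id]

/-- The whitened design in reflected coordinates consists of independent standard Gaussians. -/
lemma IsDesign.measurePreserving (hD : IsDesign S P a ε) (hS : S.PosDef) {u : E n}
    (hu : ‖u‖ = 1) {ρ τ : ℝ} (h : ρ ^ 2 + τ ^ 2 = 1) :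
    MeasurePreserving (fun ω i => planeReflection u ρ τ
        (Matrix.toEuclideanCLM (𝕜 := ℝ) (CFC.sqrt S)⁻¹ (a i ω), ε i ω))
      P (Measure.pi fun _ : Fin m => (stdGaussian (E n)).prod (gaussianReal 0 1)) := by
  have h3 : MeasurePreserving (planeReflection u ρ τ ∘
        Prod.map (Matrix.toEuclideanCLM (𝕜 := ℝ) (CFC.sqrt S)⁻¹) id)
      ((multivariateGaussian 0 S).prod (gaussianReal 0 1))
      ((stdGaussian (E n)).prod (gaussianReal 0 1)) :=
    (measurePreserving_planeReflection hu h).comp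
      ((measurePreserving_sqrt_inv hS).prod (MeasurePreserving.id (gaussianReal 0 1)))
  have h4 := hD.measurePreserving_pi
  have h5 := h3.comp_pi h4
  simp only [Function.comp_apply, Prod.map_apply, id] at h5
  exact h5

end Design

/-! ### The nonasymptotic error bound. -/

section ErrorBound

variable {b : ℕ} (q : Quantizer b)

/-- The scale `r` cancels from `Q(r z) r z ≥ μ₀ r |z|`, so the bound is uniform in `σ`, `Σ` and `x`.
This is what lets `c` depend on the quantizer alone. -/
lemma lam_lower_bound {μ₀ M r : ℝ} (hr : 0 < r) (hM : ∀ z, |q.map z| ≤ M)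
    (h : ∀ z, μ₀ * |z| ≤ q.map z * z) :
    μ₀ * ∫ z : ℝ, |z| ∂(gaussianReal 0 1) ≤ ∫ z, q.map (r * z) * z ∂(gaussianReal 0 1) := by
  have hqm := q.measurable_map
  have hid : Integrable (fun z : ℝ => z) (gaussianReal 0 1) := IsGaussian.integrable_id
  rw [← integral_const_mul]
  refine integral_mono (hid.abs.const_mul _) (hid.bdd_mul (c := M)
    (by fun_prop : Measurable fun z => q.map (r * z)).aestronglyMeasurable
    (Eventually.of_forall fun z => hM _)) fun z => ?_
  have h1 := h (r * z)
  rw [abs_mul, abs_of_pos hr] at h1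
  have h2 : r * (μ₀ * |z|) ≤ r * (q.map (r * z) * z) := by linarith
  exact le_of_mul_le_mul_left h2 hr

lemma Psi_sq_lower_bound {μ₀ M r : ℝ} (hr : 0 < r) (hμ₀ : 0 ≤ μ₀) (hM : ∀ z, |q.map z| ≤ M)
    (h : ∀ z, z ≠ 0 → μ₀ ≤ |q.map z|) :
    μ₀ ^ 2 ≤ ∫ z, q.map (r * z) ^ 2 ∂(gaussianReal 0 1) := by
  have hqm := q.measurable_map
  have hsing : NullSingletonClass (gaussianReal 0 1) := nullSingletonClass_gaussianReal (by simp)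
  have hint : Integrable (fun z => q.map (r * z) ^ 2) (gaussianReal 0 1) := by
    refine (integrable_const (M ^ 2)).mono'
      (by fun_prop : Measurable fun z => q.map (r * z) ^ 2).aestronglyMeasurable
      (Eventually.of_forall fun z => ?_)
    rw [Real.norm_of_nonneg (sq_nonneg _), ← sq_abs]
    exact pow_le_pow_left₀ (abs_nonneg _) (hM _) 2
  have hne : ∀ᵐ z ∂(gaussianReal 0 1), z ≠ 0 := by
    rw [ae_iff]; simp
  have := integral_mono_ae (integrable_const (μ₀ ^ 2)) hint (by
    filter_upwards [hne] with z hz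
    rw [← sq_abs (q.map (r * z))]
    exact pow_le_pow_left₀ hμ₀ (h _ (mul_ne_zero hr.ne' hz)) 2)
  simpa using this

variable {n m : ℕ} {S : Matrix (Fin n) (Fin n) ℝ}

/-- The decomposition of `S⁻¹ η` into the signal part and an independent Gaussian part. -/
lemma inv_apply_eta (hS : S.PosDef) {Ω : Type*} {a : Fin m → Ω → E n} {ε : Fin m → Ω → ℝ}
    {σ ψ ρ τ r : ℝ} {x u : E n} (hρτ : ρ ^ 2 + τ ^ 2 = 1) (hψ : ψ = r * ρ) (hσ : σ = r * τ)
    (hu : ‖u‖ = 1) (hxu : Matrix.toEuclideanCLM (𝕜 := ℝ) (CFC.sqrt S) x = ψ • u) (hψ0 : ψ ≠ 0)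
    (ω : Ω) {k : Fin m → E n × ℝ} (hk : ∀ i, k i = planeReflection u ρ τ
      (Matrix.toEuclideanCLM (𝕜 := ℝ) (CFC.sqrt S)⁻¹ (a i ω), ε i ω)) :
    Matrix.toEuclideanCLM (𝕜 := ℝ) S⁻¹ (eta q σ x a ε ω) =
      (m : ℝ)⁻¹ • Matrix.toEuclideanCLM (𝕜 := ℝ) (CFC.sqrt S)⁻¹
        (partialReflection u τ (∑ i, q.map (r * (k i).2) • (k i).1)) +
      ((m : ℝ)⁻¹ * ((∑ i, q.map (r * (k i).2) * (k i).2) * ρ) * ψ⁻¹) • x := by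
  set J := Matrix.toEuclideanCLM (𝕜 := ℝ) (CFC.sqrt S)⁻¹ with hJ
  have hJu : J u = ψ⁻¹ • x := by
    have := congrArg J hxu
    rw [hJ, sqrt_inv_apply_sqrt hS, map_smul] at this
    rw [this, smul_smul, inv_mul_cancel₀ hψ0, one_smul]
  -- The observation depends on the second reflected coordinate only, hence is independent of the
  -- first.
  have hobs : ∀ i, observation q σ x a ε i ω = q.map (r * (k i).2) := by
    intro i
    have h1 : ⟪a i ω, x⟫ = ψ * ⟪u, J (a i ω)⟫ := by
      conv_lhs => rw [← sqrt_apply_sqrt_inv hS (a i ω)]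
      rw [inner_sqrt_apply, hxu, inner_smul_right, real_inner_comm]
    rw [observation, h1, hk i, planeReflection, hψ, hσ]
    congr 1
    ring
  have hg : ∀ i, J (a i ω) = partialReflection u τ (k i).1 + (ρ * (k i).2) • u := by
    intro i
    rw [hk i, partialReflection_planeReflection hu hρτ]
  have hsum : J (∑ i, observation q σ x a ε i ω • a i ω) =
      partialReflection u τ (∑ i, q.map (r * (k i).2) • (k i).1) +
        ((∑ i, q.map (r * (k i).2) * (k i).2) * ρ) • u := by
    rw [map_sum, map_sum, Finset.sum_mul, Finset.sum_smul, ← Finset.sum_add_distrib]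
    refine Finset.sum_congr rfl fun i _ => ?_
    rw [map_smul, map_smul, hobs, hg, smul_add, smul_smul]
    congr 2
    ring
  rw [inv_apply_eq hS, eta, map_smul, map_smul, ← hJ, hsum, map_add, smul_add, map_smul J, hJu,
    smul_smul, smul_smul, mul_assoc]

/-- The bound for a single problem, with no limit in `n`; the asymptotic statements only compare
`exp(-w²/5)` with the required tails. -/
lemma exists_error_bound :
    ∃ c : ℝ, 0 < c ∧ ∀ (σ : ℝ) (n m : ℕ) (S : Matrix (Fin n) (Fin n) ℝ) (_ : S.PosDef)
      (K : Set (E n)) (x : E n) (_ : x ≠ 0) (_ : direction x ∈ K)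
      {Ω : Type*} [MeasurableSpace Ω] (P : Measure Ω) [IsProbabilityMeasure P]
      (a : Fin m → Ω → E n) (ε : Fin m → Ω → ℝ) (_ : IsDesign S P a ε) (p : ℝ)
      (_ : p ≤ 1 - (2 * Real.exp (-c * m) + Real.exp (-(gaussianWidth
        (sphericalPart (constraint K) (direction x)) ^ 2 / 5)))),
      ErrorBoundWithProb q σ S K x P a ε p := by
  obtain ⟨μ₀, M, hμ₀, hM, hq1, hq2, hqM⟩ := q.exists_bounds
  set e := ∫ z : ℝ, |z| ∂(gaussianReal 0 1) with he
  have he0 : 0 < e := integral_abs_gaussianReal_pos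
  refine ⟨min ((μ₀ * e) ^ 2 / (8 * M ^ 2)) (7 * μ₀ ^ 2 / M ^ 2), by positivity, ?_⟩
  -- The two terms of the minimum are the Chernoff rates for `∑ yᵢ zᵢ` and `∑ yᵢ²`, with the means
  -- replaced by their uniform lower bounds.
  intro σ n m S hS K x hx hxK Ω _ P _ a ε hD p hp
  set c := min ((μ₀ * e) ^ 2 / (8 * M ^ 2)) (7 * μ₀ ^ 2 / M ^ 2) with hc
  set T := sphericalPart (constraint K) (direction x) with hTdef
  have hT : T ⊆ Metric.sphere 0 1 := sphericalPart_subset _ _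
  set w := gaussianWidth T with hw
  have hw0 : 0 ≤ w := gaussianWidth_nonneg hT
  have hψ0 : 0 < scale S x := scale_pos hS hx
  set ψ := scale S x with hψdef
  set r := √(ψ ^ 2 + σ ^ 2) with hrdef
  have hr : 0 < r := Real.sqrt_pos.2 (by positivity)
  have hr2 : r ^ 2 = ψ ^ 2 + σ ^ 2 := Real.sq_sqrt (by positivity)
  obtain ⟨ρ, hρ⟩ : ∃ ρ, ρ = ψ / r := ⟨_, rfl⟩
  obtain ⟨τ, hτ⟩ : ∃ τ, τ = σ / r := ⟨_, rfl⟩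
  have hψ : ψ = r * ρ := by rw [hρ]; field_simp
  have hσ : σ = r * τ := by rw [hτ]; field_simp
  have hρτ : ρ ^ 2 + τ ^ 2 = 1 := by
    rw [hρ, hτ, div_pow, div_pow, ← add_div, ← hr2, div_self (by positivity)]
  have hρ0 : 0 < ρ := by rw [hρ]; positivity
  have hτ1 : τ ^ 2 ≤ 1 := by nlinarith [sq_nonneg ρ]
  set R := Matrix.toEuclideanCLM (𝕜 := ℝ) (CFC.sqrt S) with hR
  set J := Matrix.toEuclideanCLM (𝕜 := ℝ) (CFC.sqrt S)⁻¹ with hJ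
  have hψR : ψ = ‖R x‖ := rfl
  set u : E n := ψ⁻¹ • R x with hu
  have hun : ‖u‖ = 1 := by
    rw [hu, norm_smul, norm_inv, Real.norm_of_nonneg hψ0.le, ← hψR, inv_mul_cancel₀ hψ0.ne']
  have hxu : R x = ψ • u := by rw [hu, smul_smul, mul_inv_cancel₀ hψ0.ne', one_smul]
  have hJ0 : 0 < ‖J‖ := by
    refine norm_pos_iff.2 fun h => hx ?_
    rw [← sqrt_inv_apply_sqrt hS x, ← hJ, h]
    rfl
  set B := partialReflection u τ with hB
  have hB1 : ‖B‖ ≤ 1 := norm_partialReflection_le hun hτ1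
  set s : Seminorm ℝ (E n) := (widthSeminorm T hT).comp (J.comp B : E n →ₗ[ℝ] E n) with hs
  have hsJ : LipschitzWith ‖J‖₊ s := by
    refine (lipschitzWith_widthSeminorm_comp hT (J.comp B)).weaken ?_
    rw [← NNReal.coe_le_coe, coe_nnnorm, coe_nnnorm]
    exact (J.opNorm_comp_le B).trans (mul_le_of_le_one_right hJ0.le hB1)
  have hsw : ∫ k, s k ∂(stdGaussian (E n)) ≤ ‖J‖₊ * w :=
    integral_widthSeminorm_comp_le hT J B hB1
  have hqm := q.measurable_map
  set l := ∫ z, q.map (r * z) * z ∂(gaussianReal 0 1) with hl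
  have hle : μ₀ * e ≤ l := lam_lower_bound q hr hqM hq1
  have hl0 : 0 < l := lt_of_lt_of_le (by positivity) hle
  have hPsi : Psi q σ ψ ^ 2 = ∫ z, q.map (r * z) ^ 2 ∂(gaussianReal 0 1) :=
    Psi_sq_eq q hρτ hψ hσ
  have hPsi0 : 0 ≤ Psi q σ ψ := Real.sqrt_nonneg _
  have hPsiμ : μ₀ ^ 2 ≤ Psi q σ ψ ^ 2 := by
    rw [hPsi]; exact Psi_sq_lower_bound q hr hμ₀.le hqM hq2
  have hlam : lam q σ ψ = ρ * l := lam_eq q hρτ hψ hσ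
  have hmp := hD.measurePreserving hS hun hρτ
  have hQm : Measurable fun z => q.map (r * z) := by fun_prop
  have hGm := measurableSet_goodEvent (V := E n) hQm
    hsJ.continuous.measurable ‖J‖ w m
  have hprob := measureReal_compl_goodEvent_le (V := E n) hQm hM
    (fun z => hqM _) (fun z => by
      have h1 := hq1 (r * z)
      rw [abs_mul, abs_of_pos hr] at h1
      have h2 : 0 ≤ r * (q.map (r * z) * z) :=
        le_trans (by positivity : 0 ≤ μ₀ * (r * |z|)) (h1.trans (le_of_eq (by ring)))
      exact nonneg_of_mul_nonneg_right h2 hr) hsJ (nnnorm_pos.2 (norm_pos_iff.1 hJ0))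
    hw0 hsw m
  rw [← hl, ← hPsi, coe_nnnorm] at hprob
  refine ⟨_, hmp.measurable hGm, ?_, ?_⟩
  · have h1 := probReal_compl_eq_one_sub (μ := P) (hmp.measurable hGm)
    rw [← Set.preimage_compl, hmp.measureReal_preimage hGm.compl.nullMeasurableSet] at h1
    have hm0 : (0 : ℝ) ≤ m := Nat.cast_nonneg m
    have h2 : Real.exp (-(l ^ 2 / (8 * M ^ 2)) * m) ≤ Real.exp (-c * m) := by
      refine Real.exp_le_exp.2 (mul_le_mul_of_nonneg_right (neg_le_neg ?_) hm0)
      refine (min_le_left _ _).trans ?_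
      gcongr
    have h3 : Real.exp (-(7 * Psi q σ ψ ^ 2 / M ^ 2) * m) ≤ Real.exp (-c * m) := by
      refine Real.exp_le_exp.2 (mul_le_mul_of_nonneg_right (neg_le_neg ?_) hm0)
      refine (min_le_right _ _).trans ?_
      gcongr
    linarith
  · intro ω hω xhat hest
    obtain ⟨g1, g2, g3⟩ := hω
    rw [← hl] at g1
    rw [← hPsi] at g2
    set k : Fin m → E n × ℝ := fun i => planeReflection u ρ τ (J (a i ω), ε i ω) with hk
    set A := ∑ i, q.map (r * (k i).2) * (k i).2 with hA
    set Y := ∑ i, q.map (r * (k i).2) ^ 2 with hY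
    have hη := inv_apply_eta q hS hρτ hψ hσ hun hxu hψ0.ne' ω (k := k) (fun i => rfl)
    rw [← hJ, ← hB, ← hA] at hη
    -- The strict inequality for `∑ yᵢ²` fails when `m = 0`, so the good event is then empty.
    have hm0 : 0 < (m : ℝ) := by
      rcases Nat.eq_zero_or_pos m with h | h
      · exfalso
        have hY0 : 0 ≤ Y := Finset.sum_nonneg fun i _ => sq_nonneg _
        rw [h, Nat.cast_zero, zero_mul, mul_zero] at g2
        linarith
      · exact_mod_cast h
    have hA0 : 0 < A := lt_trans (by positivity) g1
    have hYsqrt : √Y ≤ 3 * (√m * Psi q σ ψ) := by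
      refine Real.sqrt_le_iff.2 ⟨by positivity, g2.le.trans (le_of_eq ?_)⟩
      rw [mul_pow, mul_pow, Real.sq_sqrt hm0.le]
      ring
    have hdet := mul_norm_sub_direction_le hx hxK
      (δ := (m : ℝ)⁻¹ * (3 * (√m * Psi q σ ψ) * (2 * ‖J‖ * w))) (by positivity) (by positivity) hη
      (fun v hv => by
        rw [real_inner_smul_left, abs_mul, abs_of_pos (inv_pos.2 hm0)]
        refine mul_le_mul_of_nonneg_left ?_ (inv_pos.2 hm0).le
        refine (abs_inner_le_widthSeminorm hT hv _).trans (g3.trans ?_)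
        gcongr) hest
    set d := ‖xhat - direction x‖ with hd
    have hd0 : 0 ≤ d := norm_nonneg _
    have hx0 : 0 < ‖x‖ := norm_pos_iff.2 hx
    -- Trades the factor `ψ` for `‖R‖ ‖x‖`; `‖x‖` cancels and `‖R‖` joins `‖J‖` to form the
    -- condition number.
    have hψle : ψ ≤ ‖R‖ * ‖x‖ := R.le_opNorm x
    have hsm : 0 < √(m : ℝ) := Real.sqrt_pos.2 hm0
    have hsm2 : √(m : ℝ) * √(m : ℝ) = m := Real.mul_self_sqrt hm0.le
    have s1 : A * ρ * ‖x‖ * d ≤ 12 * (√m * Psi q σ ψ * ‖J‖ * w) * ψ := by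
      have := mul_le_mul_of_nonneg_left hdet (mul_pos hm0 hψ0).le
      have e1 : (m * ψ) * ((m : ℝ)⁻¹ * (A * ρ) * ψ⁻¹ * ‖x‖ * d) = A * ρ * ‖x‖ * d := by
        field_simp
      have e2 : (m * ψ) * (2 * ((m : ℝ)⁻¹ * (3 * (√m * Psi q σ ψ) * (2 * ‖J‖ * w)))) =
          12 * (√m * Psi q σ ψ * ‖J‖ * w) * ψ := by
        field_simp; ring
      rwa [e1, e2] at this
    have s2 : m * l / 2 * ρ * ‖x‖ * d ≤ 12 * (√m * Psi q σ ψ * ‖J‖ * w) * (‖R‖ * ‖x‖) := by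
      calc m * l / 2 * ρ * ‖x‖ * d ≤ A * ρ * ‖x‖ * d := by gcongr
        _ ≤ _ := s1
        _ ≤ _ := by gcongr
    have s3 : d * (ρ * l * √m) ≤ 24 * (‖R‖ * ‖J‖) * Psi q σ ψ * w := by
      have h1 : (√m * ‖x‖) * (d * (ρ * l * √m)) ≤
          (√m * ‖x‖) * (24 * (‖R‖ * ‖J‖) * Psi q σ ψ * w) := by
        calc (√m * ‖x‖) * (d * (ρ * l * √m)) = 2 * (√m * √m * l / 2 * ρ * ‖x‖ * d) := by ring
          _ ≤ 2 * (12 * (√m * Psi q σ ψ * ‖J‖ * w) * (‖R‖ * ‖x‖)) := by rw [hsm2]; linarith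
          _ = _ := by ring
      exact le_of_mul_le_mul_left h1 (by positivity)
    have hκ : condNumber (CFC.sqrt S) = ‖R‖ * ‖J‖ := rfl
    rw [hlam, hκ]
    have e3 : 24 * (‖R‖ * ‖J‖) * (Psi q σ ψ / (ρ * l)) * (w / √m) =
        24 * (‖R‖ * ‖J‖) * Psi q σ ψ * w / (ρ * l * √m) := by
      field_simp
    rw [e3, le_div_iff₀ (by positivity)]
    exact s3

end ErrorBound

end QuantizedRecovery

/-! ### Passage to the stated probabilities. -/

open QuantizedRecovery in
theorem theorem2 {b : ℕ} (hb : 1 ≤ b) (q : Quantizer b) :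
    ∃ c : ℝ, 0 < c ∧
      ∀ (σ : ℝ) (_ : 0 ≤ σ)
        -- a sequence of problems whose dimension `n k` tends to infinity
        (n m : ℕ → ℕ) (_ : Tendsto n atTop atTop)
        (S : ∀ k, Matrix (Fin (n k)) (Fin (n k)) ℝ) (_ : ∀ k, (S k).PosDef)
        (K : ∀ k, Set (E (n k)))
        (x : ∀ k, E (n k)) (_ : ∀ k, x k ≠ 0) (_ : ∀ k, direction (x k) ∈ K k)
        (Ω : ℕ → Type*) [∀ k, MeasurableSpace (Ω k)]
        (P : ∀ k, Measure (Ω k)) [∀ k, IsProbabilityMeasure (P k)]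
        (a : ∀ k, Fin (m k) → Ω k → E (n k)) (ε : ∀ k, Fin (m k) → Ω k → ℝ)
        (_ : ∀ k, IsDesign (S k) (P k) (a k) (ε k))
        -- condition (C): the sup norm of the direction tends to zero
        (_ : Tendsto (fun k => ⨆ j, |direction (x k) j|) atTop (𝓝 0))
        (κ w : ℕ → ℝ) (_ : ∀ k, κ k = condNumber (CFC.sqrt (S k)))
        (_ : ∀ k, w k = gaussianWidth (sphericalPart (constraint (K k)) (direction (x k)))),
        (∀ᶠ k in atTop, ErrorBoundWithProb q σ (S k) (K k) (x k) (P k) (a k) (ε k)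
          (1 - 4 * (Real.exp (-(w k) / 2) + Real.exp (-c * m k)))) ∧
        (κ =o[atTop] w →
          (∀ᶠ k in atTop, ErrorBoundWithProb q σ (S k) (K k) (x k) (P k) (a k) (ε k)
            (1 - 4 * (Real.exp (-(κ k * w k) / 2) + Real.exp (-c * m k)))) ∧
          Tendsto (fun k => 4 * Real.exp (-(κ k * w k) / 2)) atTop (𝓝 0)) := by
  obtain ⟨c, hc, hmain⟩ := exists_error_bound q
  refine ⟨c, hc, ?_⟩
  intro σ _ n m _ S hS K x hx hxK Ω _ P _ a ε hD _ κ w hκ hw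
  have hw0 : ∀ k, 0 ≤ w k := fun k => by
    rw [hw]; exact gaussianWidth_nonneg (sphericalPart_subset _ _)
  have hκ1 : ∀ k, 1 ≤ κ k := fun k => by rw [hκ]; exact one_le_condNumber_sqrt (hS k) (hx k)
  have hbound : ∀ k t, Real.exp (-(w k ^ 2 / 5)) ≤ 4 * Real.exp t →
      ErrorBoundWithProb q σ (S k) (K k) (x k) (P k) (a k) (ε k)
        (1 - 4 * (Real.exp t + Real.exp (-c * m k))) := by
    intro k t ht
    refine hmain σ (n k) (m k) (S k) (hS k) (K k) (x k) (hx k) (hxK k) (P k) (a k) (ε k) (hD k) _ ?_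
    rw [← hw]
    have := Real.exp_pos (-c * m k)
    linarith
  refine ⟨Eventually.of_forall fun k => hbound k _ ?_, fun ho => ⟨?_, ?_⟩⟩
  -- `w² / 5 - w / 2 + 1` has negative discriminant, and the resulting factor `e` is absorbed by the
  -- prefactor `4`.
  · have h1 : Real.exp (-(w k ^ 2 / 5)) ≤ Real.exp (1 + -(w k) / 2) := by
      refine Real.exp_le_exp.2 ?_
      nlinarith [sq_nonneg (w k - 5 / 4)]
    rw [Real.exp_add] at h1
    have h2 : Real.exp 1 ≤ 4 := by linarith [Real.exp_one_lt_d9]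
    exact h1.trans (mul_le_mul_of_nonneg_right h2 (Real.exp_pos _).le)
  -- Eventually `κ ≤ w / 5`, so `κ w / 2 ≤ w² / 10`.
  · filter_upwards [ho.bound (show (0 : ℝ) < 1 / 5 by norm_num)] with k hk
    rw [Real.norm_of_nonneg (by linarith [hκ1 k]), Real.norm_of_nonneg (hw0 k)] at hk
    refine hbound k _ ?_
    have h1 : Real.exp (-(w k ^ 2 / 5)) ≤ Real.exp (-(κ k * w k) / 2) := by
      refine Real.exp_le_exp.2 ?_
      nlinarith [mul_le_mul_of_nonneg_right hk (hw0 k), sq_nonneg (w k)]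
    linarith [Real.exp_pos (-(κ k * w k) / 2)]
  -- Since `κ ≥ 1`, the condition `κ = o(w)` forces `w → ∞`.
  · have hwtop : Tendsto w atTop atTop := by
      refine tendsto_atTop.2 fun C => ?_
      filter_upwards [ho.bound (show (0 : ℝ) < (|C| + 1)⁻¹ by positivity)] with k hk
      rw [Real.norm_of_nonneg (by linarith [hκ1 k]), Real.norm_of_nonneg (hw0 k),
        le_inv_mul_iff₀ (by positivity)] at hk
      have := hκ1 k
      nlinarith [le_abs_self C, abs_nonneg C]
    have hκw : Tendsto (fun k => κ k * w k) atTop atTop :=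
      tendsto_atTop_mono (fun k => le_mul_of_one_le_left (hw0 k) (hκ1 k)) hwtop
    have h2 : Tendsto (fun k => -(κ k * w k) / 2) atTop atBot := by
      have := (hκw.atTop_div_const (show (0 : ℝ) < 2 by norm_num))
      refine (tendsto_neg_atTop_atBot.comp this).congr fun k => ?_
      simp only [Function.comp_apply]; ring
    simpa using (Real.tendsto_exp_atBot.comp h2).const_mul 4
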